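/- Let $\mathfrak C=\{0,1\}^{\mathbf N}$ be the Cantor space. For a finite word $m$ in $0,1$ let $I_m=\{m\cdot z: z\in\mathfrak C\}$ be the standard dyadic interval of sequences with prefix $m$; a standard dyadic partition is a finite partition of $\mathfrak C$ into such sets. Thompson's group $V$ is the group of homeomorphisms $v$ of $\mathfrak C$ for which there are standard dyadic partitions $(I_{m_k})_{1\le k\le n}$ and $(I_{w_k})_{1\le k\le n}$ with $v(m_k\cdot z)=w_k\cdot z$ for all $1\le k\le n$ and $z\in\mathfrak C$. For a group $\Gamma$ let $L\Gamma$ be the group of locally constant maps $\mathfrak C\to\Gamma$ under pointwise multiplication, and $\operatorname{supp}(a)=\{x\in\mathfrak C: a(x)\neq e\}$ for $a\in L\Gamma$. Given automorphisms $\alpha_0,\alpha_1$ of $\Gamma$ and a word $m=l_1\cdots l_n$, put $\alpha_m=\alpha_{l_n}\circ\cdots\circ\alpha_{l_1}$. For $v\in V$ and $x\in\mathfrak C$ put $\tau_{v,x}=\alpha_w^{-1}\circ\alpha_m\in\mathrm{Aut}(\Gamma)$, where $m,w$ are words such that $x\in I_m$ and $v(m\cdot z)=w\cdot z$ for all $z\in\mathfrak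 C$ (this does not depend on the choice of $m,w$). The formula $\pi_v(a)(vx)=\tau_{v,x}(a(x))$ defines an action $\pi$ of $V$ on $L\Gamma$ by automorphisms, and the (twisted) fraction group of $(\Gamma,\alpha_0,\alpha_1)$ is the semidirect product $G=L\Gamma\rtimes_\pi V$. **Theorem.** Let $(\Gamma,\alpha_0,\alpha_1)$ and $(\tilde\Gamma,\tilde\alpha_0,\tilde\alpha_1)$ be two groups, each with a pair of automorphisms, let $G=L\Gamma\rtimes V$ and $\tilde G=L\tilde\Gamma\rtimes V$ be their fraction groups, with associated maps $\tau,\tilde\tau$ and actions $\pi,\tilde\pi$, and let $\theta:G\to\tilde G$ be an isomorphism. Then there exist a group morphism $\zeta:G\to Z(\tilde G)$ into the centre of $\tilde G$, a homeomorphism $\varphi$ of $\mathfrak C$ that normalises $V$ (write $\mathrm{ad}_\varphi(v)=\varphi v\varphi^{-1}$), a group isomorphism $\kappa^0:L\Gamma\to L\tilde\Gamma$, and a cocycle $c:V\to L\tilde\Gamma$, i.e. a map with $c_{vw}=c_v\cdot\tilde\pi_{\mathrm{ad}_\varphi(v)}(c_w)$ for all $v,w\in V$, such that $$\theta(av)=\zeta(a)\cdot\kappa^0(a)\cdot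 c_v\cdot\mathrm{ad}_\varphi(v)\qquad\text{for all }a\in L\Gamma,\ v\in V,$$ and such that moreover: 1. $\operatorname{supp}(\kappa^0(a))=\varphi(\operatorname{supp}(a))$ for all $a\in L\Gamma$; 2. there is a family of group isomorphisms $\kappa^0_x:\Gamma\to\tilde\Gamma$, $x\in\mathfrak C$, with $\kappa^0(a)(\varphi(x))=\kappa^0_x(a(x))$ for all $a\in L\Gamma$, $x\in\mathfrak C$; 3. for all $x\in\mathfrak C$ and $v\in V$, $$\kappa^0_{vx}\circ\tau_{v,x}=\mathrm{ad}(c_v(\varphi(vx)))\circ\tilde\tau_{\mathrm{ad}_\varphi(v),\varphi(x)}\circ\kappa^0_x,$$ where $\mathrm{ad}(h)(g)=hgh^{-1}$. -/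

import Mathlib

/-- The Cantor space `{0,1}^ℕ` with the product topology (`false` is `0`, `true` is `1`). -/
abbrev Cantor : Type := ℕ → Bool

namespace Cantor

/-- The sequence `b · x` for a letter `b` and an infinite sequence `x`. -/
def cons (b : Bool) (x : Cantor) : Cantor
  | 0 => b
  | n + 1 => x n

/-- The concatenation `m · x` of a finite word `m` and an infinite sequence `x`. -/
def prepend : List Bool → Cantor → Cantor
  | [], x => x
  | b :: m, x => cons b (prepend m x)

/-- The standard dyadic interval of all the sequences with prefix `m`. -/
def sdi (m : List Bool) : Set Cantor := Set.range (prepend m)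

/-- The standard dyadic intervals with words `m 0, …, m (n-1)` form a partition of the Cantor
space. -/
def IsSdp {n : ℕ} (m : Fin n → List Bool) : Prop := ∀ x : Cantor, ∃! k, x ∈ sdi (m k)

/-- The map `v` replaces the prefix `m` by the prefix `w`: the standard dyadic interval of `m`
is adapted to `v`, and its image is the standard dyadic interval of `w`. -/
def Adapted (v : Cantor → Cantor) (m w : List Bool) : Prop :=
  ∀ z : Cantor, v (prepend m z) = prepend w z

theorem cons_inj {a b : Bool} {x y : Cantor} (h : cons a x = cons b y) : a = b ∧ x = y :=
  ⟨congrFun h 0, funext fun n => congrFun h (n + 1)⟩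

theorem cons_head_tail (x : Cantor) : cons (x 0) (fun n => x (n + 1)) = x := by
  funext n; cases n <;> rfl

theorem prepend_append (m w : List Bool) (x : Cantor) :
    prepend (m ++ w) x = prepend m (prepend w x) := by
  induction m with
  | nil => rfl
  | cons b m ih => simp [prepend, ih]

theorem prepend_compare {a b : List Bool} {y z : Cantor} (h : prepend a y = prepend b z) :
    (∃ u, b = a ++ u ∧ y = prepend u z) ∨ (∃ u, a = b ++ u ∧ z = prepend u y) := by
  induction a generalizing b with
  | nil => exact Or.inl ⟨b, rfl, h⟩
  | cons c a ih =>
    cases b with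
    | nil => exact Or.inr ⟨c :: a, rfl, h.symm⟩
    | cons d b =>
      obtain ⟨rfl, h'⟩ := cons_inj h
      rcases ih h' with ⟨u, rfl, hu⟩ | ⟨u, rfl, hu⟩
      · exact Or.inl ⟨u, rfl, hu⟩
      · exact Or.inr ⟨u, rfl, hu⟩

theorem eq_nil_of_prepend {u : List Bool} (h : ∀ z, z = prepend u z) : u = [] := by
  cases u with
  | nil => rfl
  | cons b u =>
    have h0 := congrFun (h fun _ => !b) 0
    simp [prepend, cons] at h0

theorem word_ext {a b : List Bool} (h : ∀ z, prepend a z = prepend b z) : a = b := by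
  have key : ∀ {a b : List Bool} {u : List Bool}, (∀ z, prepend a z = prepend b z) →
      b = a ++ u → a = b := by
    intro a b u h hb
    have hu : u = [] := by
      refine eq_nil_of_prepend fun z => ?_
      have hz := h z
      rw [hb, prepend_append] at hz
      clear h hb
      induction a with
      | nil => exact hz
      | cons c a ih => exact ih (cons_inj hz).2
    simp [hb, hu]
  rcases prepend_compare (h fun _ => false) with ⟨u, hu, -⟩ | ⟨u, hu, -⟩
  · exact key h hu
  · exact (key (fun z => (h z).symm) hu).symm

theorem exists_word (N : ℕ) (x : Cantor) : ∃ m : List Bool, m.length = N ∧ x ∈ sdi m := by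
  induction N generalizing x with
  | zero => exact ⟨[], rfl, x, rfl⟩
  | succ N ih =>
    obtain ⟨m, hm, z, hz⟩ := ih fun n => x (n + 1)
    refine ⟨x 0 :: m, by simp [hm], z, ?_⟩
    rw [prepend, hz, cons_head_tail]

theorem isOpen_sdi (m : List Bool) : IsOpen (sdi m) := by
  induction m with
  | nil =>
    have h : sdi [] = Set.univ := Set.range_eq_univ.2 fun x => ⟨x, rfl⟩
    rw [h]; exact isOpen_univ
  | cons b m ih =>
    have h : sdi (b :: m) =
        (fun x : Cantor => x 0) ⁻¹' {b} ∩ (fun (x : Cantor) (n : ℕ) => x (n + 1)) ⁻¹' sdi m := by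
      ext x
      constructor
      · rintro ⟨z, rfl⟩
        exact ⟨rfl, z, rfl⟩
      · rintro ⟨h0, z, hz⟩
        refine ⟨z, ?_⟩
        have h0' : x 0 = b := h0
        have hz' : prepend m z = fun n => x (n + 1) := hz
        rw [prepend, hz', ← h0', cons_head_tail]
    rw [h]
    exact ((isOpen_discrete _).preimage (continuous_apply 0)).inter
      (ih.preimage (continuous_pi fun n => continuous_apply (n + 1)))

theorem Adapted.append {v : Cantor → Cantor} {m w : List Bool} (h : Adapted v m w)
    (u : List Bool) : Adapted v (m ++ u) (w ++ u) := fun z => by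
  rw [prepend_append, prepend_append]; exact h _

/-- `v` is given by prefix replacements between two standard dyadic partitions. -/
def IsThompson (v : Cantor ≃ₜ Cantor) : Prop :=
  ∃ (n : ℕ) (p q : Fin n → List Bool), IsSdp p ∧ IsSdp q ∧ ∀ k, Adapted v (p k) (q k)

theorem isThompson_iff (v : Cantor ≃ₜ Cantor) :
    IsThompson v ↔ ∀ x : Cantor, ∃ m w, x ∈ sdi m ∧ Adapted v m w := by
  constructor
  · rintro ⟨n, p, q, hp, -, h⟩ x
    obtain ⟨k, hk, -⟩ := hp x
    exact ⟨p k, q k, hk, h k⟩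
  · intro h
    choose m w hm hw using h
    obtain ⟨t, ht⟩ := isCompact_univ.elim_finite_subcover (fun x => sdi (m x))
      (fun x => isOpen_sdi _) (fun x _ => Set.mem_iUnion.2 ⟨x, hm x⟩)
    let N : ℕ := t.sup fun x => (m x).length
    have key : ∀ r : List Bool, r.length = N → ∃ s, Adapted v r s := by
      intro r hr
      obtain ⟨i, hi, y, hy⟩ := Set.mem_iUnion₂.1 (ht (Set.mem_univ (prepend r fun _ => false)))
      have hlen : (m i).length ≤ r.length := by
        rw [hr]; exact Finset.le_sup (f := fun x => (m x).length) hi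
      have hpre : ∃ u, r = m i ++ u := by
        rcases prepend_compare hy with ⟨u, hu, -⟩ | ⟨u, hu, -⟩
        · exact ⟨u, hu⟩
        · rw [hu, List.length_append] at hlen
          have : u = [] := List.length_eq_zero_iff.1 (by omega)
          exact ⟨[], by simp [hu, this]⟩
      obtain ⟨u, rfl⟩ := hpre
      exact ⟨_, (hw i).append u⟩
    choose s hs using key
    obtain ⟨n, ⟨e⟩⟩ : ∃ n : ℕ, Nonempty (Fin n ≃ {r : List Bool // r.length = N}) :=
      ⟨_, ⟨(Fintype.equivFin (List.Vector Bool N)).symm⟩⟩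
    have hp : IsSdp fun k => (e k).1 := by
      intro x
      obtain ⟨r, hr, hx⟩ := exists_word N x
      refine ⟨e.symm ⟨r, hr⟩, by simpa using hx, fun k hk => ?_⟩
      apply e.injective
      apply Subtype.ext
      rw [Equiv.apply_symm_apply]
      obtain ⟨y, hy : prepend (e k).1 y = x⟩ := hk
      obtain ⟨z, hz⟩ := hx
      have h1 : (e k).1.length = N := (e k).2
      rcases prepend_compare (hy.trans hz.symm) with ⟨u, hu, -⟩ | ⟨u, hu, -⟩
      · have hl := congrArg List.length hu
        rw [List.length_append] at hl
        have : u = [] := List.length_eq_zero_iff.1 (by omega)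
        simp [hu, this]
      · have hl := congrArg List.length hu
        rw [List.length_append] at hl
        have : u = [] := List.length_eq_zero_iff.1 (by omega)
        simp [hu, this]
    refine ⟨_, fun k => (e k).1, fun k => s (e k).1 (e k).2, hp, ?_, fun k => hs _ _⟩
    intro y
    obtain ⟨k, ⟨z, hz⟩, hk'⟩ := hp (v.symm y)
    refine ⟨k, ⟨z, ?_⟩, ?_⟩
    · show prepend (s (e k).1 (e k).2) z = y
      rw [← hs _ (e k).2 z, hz, v.apply_symm_apply]
    · rintro j ⟨z', hz'⟩
      refine hk' j ⟨z', ?_⟩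
      show prepend (e j).1 z' = v.symm y
      rw [← hz', ← hs _ (e j).2 z', v.symm_apply_apply]

theorem Adapted.comp {v w : Cantor → Cantor} {x : Cantor}
    (hw : ∃ m r, x ∈ sdi m ∧ Adapted w m r) (hv : ∃ m r, w x ∈ sdi m ∧ Adapted v m r) :
    ∃ m r s, x ∈ sdi m ∧ Adapted w m r ∧ Adapted v r s := by
  obtain ⟨m, r, ⟨y, rfl⟩, hmr⟩ := hw
  obtain ⟨m', r', ⟨z, hz⟩, hmr'⟩ := hv
  rw [hmr y] at hz
  rcases prepend_compare hz with ⟨u, rfl, -⟩ | ⟨u, rfl, rfl⟩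
  · exact ⟨m, _, _, ⟨y, rfl⟩, hmr, hmr'.append u⟩
  · exact ⟨m ++ u, _, _, ⟨z, prepend_append _ _ _⟩, hmr.append u, hmr'⟩

end Cantor

open Cantor in
/-- Thompson's group `V` as a subgroup of the homeomorphism group of the Cantor space. -/
def ThompsonV : Subgroup (Cantor ≃ₜ Cantor) where
  carrier := {v | IsThompson v}
  one_mem' := (isThompson_iff 1).2 fun x => ⟨[], [], ⟨x, rfl⟩, fun _ => rfl⟩
  mul_mem' := by
    intro v w hv hw
    refine (isThompson_iff _).2 fun x => ?_
    obtain ⟨m, r, s, hx, h1, h2⟩ :=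
      Adapted.comp ((isThompson_iff w).1 hw x) ((isThompson_iff v).1 hv (w x))
    exact ⟨m, s, hx, fun z => by rw [Homeomorph.mul_apply, h1 z, h2 z]⟩
  inv_mem' := by
    rintro v ⟨n, p, q, hp, hq, h⟩
    exact ⟨n, q, p, hq, hp, fun k z => by rw [← h k z]; exact v.symm_apply_apply _⟩

namespace ThompsonV

open Cantor

theorem exists_adapted (v : ThompsonV) (x : Cantor) :
    ∃ mw : List Bool × List Bool, x ∈ sdi mw.1 ∧ Adapted v.1 mw.1 mw.2 := by
  obtain ⟨m, w, h⟩ := (isThompson_iff v.1).1 v.2 x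
  exact ⟨(m, w), h⟩

/-- `ad φ v = φ v φ⁻¹`, for `φ` in the normaliser of `V` in the homeomorphism group. -/
abbrev ad (φ : Subgroup.normalizer (ThompsonV : Set (Cantor ≃ₜ Cantor))) (v : ThompsonV) :
    ThompsonV :=
  ThompsonV.normalizerMonoidHom φ v

end ThompsonV

/-- The discrete loop group `LΓ` of locally constant maps from the Cantor space to `Γ`, with
pointwise multiplication. -/
abbrev LoopGroup (Γ : Type*) : Type _ := LocallyConstant Cantor Γ

section Twist

open Cantor

variable {Γ : Type*} [Group Γ] (α₀ α₁ : MulAut Γ)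

/-- For a word `m = l₁ ⋯ lₙ`, the automorphism `α_m = α_{lₙ} ∘ ⋯ ∘ α_{l₁}`. -/
def wordAut : List Bool → MulAut Γ
  | [] => 1
  | b :: m => wordAut m * (if b then α₁ else α₀)

theorem wordAut_append (m w : List Bool) :
    wordAut α₀ α₁ (m ++ w) = wordAut α₀ α₁ w * wordAut α₀ α₁ m := by
  induction m with
  | nil => simp [wordAut]
  | cons b m ih => simp [wordAut, ih, mul_assoc]

/-- The automorphism `τ_{v,x} = α_{v(I)}⁻¹ ∘ α_I`, where `I` is any standard dyadic interval
that contains `x` and is adapted to `v`; see `tau_eq` for the independence of `I`. -/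
noncomputable def tau (v : ThompsonV) (x : Cantor) : MulAut Γ :=
  (wordAut α₀ α₁ (ThompsonV.exists_adapted v x).choose.2)⁻¹ *
    wordAut α₀ α₁ (ThompsonV.exists_adapted v x).choose.1

theorem tau_eq (v : ThompsonV) {x : Cantor} {m w : List Bool} (hx : x ∈ sdi m)
    (h : Adapted v.1 m w) :
    tau α₀ α₁ v x = (wordAut α₀ α₁ w)⁻¹ * wordAut α₀ α₁ m := by
  have key : ∀ {m w m' w' : List Bool} (u : List Bool), Adapted v.1 m w → Adapted v.1 m' w' →
      m' = m ++ u → (wordAut α₀ α₁ w')⁻¹ * wordAut α₀ α₁ m' =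
        (wordAut α₀ α₁ w)⁻¹ * wordAut α₀ α₁ m := by
    rintro m w m' w' u h h' rfl
    have hw : w' = w ++ u := word_ext fun z => by rw [← h' z, ← h.append u z]
    rw [hw, wordAut_append, wordAut_append]
    group
  obtain ⟨h1, h2⟩ := (ThompsonV.exists_adapted v x).choose_spec
  obtain ⟨y, hy⟩ := h1
  obtain ⟨z, hz⟩ := hx
  unfold tau
  rcases prepend_compare (hy.trans hz.symm) with ⟨u, hu, -⟩ | ⟨u, hu, -⟩
  · exact (key u h2 h hu).symm
  · exact key u h h2 hu

theorem tau_one (x : Cantor) : tau α₀ α₁ 1 x = 1 := by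
  have h := tau_eq α₀ α₁ 1 (x := x) (m := []) (w := []) ⟨x, rfl⟩ fun _ => rfl
  rw [h]
  simp

theorem tau_mul (v w : ThompsonV) (x : Cantor) :
    tau α₀ α₁ (v * w) x = tau α₀ α₁ v (w.1 x) * tau α₀ α₁ w x := by
  obtain ⟨m, r, s, ⟨y, rfl⟩, h1, h2⟩ := Adapted.comp ((isThompson_iff w.1).1 w.2 x)
    ((isThompson_iff v.1).1 v.2 (w.1 x))
  rw [tau_eq α₀ α₁ (v * w) ⟨y, rfl⟩ (m := m) (w := s)
      fun z => by rw [← h2 z, ← h1 z]; rfl,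
    tau_eq α₀ α₁ w ⟨y, rfl⟩ h1, tau_eq α₀ α₁ v ⟨y, (h1 y).symm⟩ h2]
  group

theorem isLocallyConstant_tau (v : ThompsonV) : IsLocallyConstant (tau α₀ α₁ v) := by
  rw [IsLocallyConstant.iff_exists_open]
  intro x
  obtain ⟨⟨m, w⟩, hx, h⟩ := ThompsonV.exists_adapted v x
  exact ⟨sdi m, isOpen_sdi m, hx, fun y hy => by
    rw [tau_eq α₀ α₁ v hy h, tau_eq α₀ α₁ v hx h]⟩

/-- The map `π_v(a)`, determined by `π_v(a)(v x) = τ_{v,x}(a(x))`. -/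
noncomputable def jonesFun (v : ThompsonV) (a : LoopGroup Γ) : LoopGroup Γ where
  toFun y := tau α₀ α₁ v (v.1.symm y) (a (v.1.symm y))
  isLocallyConstant := by
    have h := ((isLocallyConstant_tau α₀ α₁ v).prodMk a.isLocallyConstant).comp
      fun p : MulAut Γ × Γ => p.1 p.2
    exact h.comp_continuous v.1.symm.continuous

theorem jonesFun_apply (v : ThompsonV) (a : LoopGroup Γ) (x : Cantor) :
    jonesFun α₀ α₁ v a (v.1 x) = tau α₀ α₁ v x (a x) := by
  show tau α₀ α₁ v (v.1.symm (v.1 x)) (a (v.1.symm (v.1 x))) = _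
  rw [v.1.symm_apply_apply]

theorem jonesFun_one (a : LoopGroup Γ) : jonesFun α₀ α₁ 1 a = a := by
  ext x
  have h := jonesFun_apply α₀ α₁ 1 a x
  rwa [tau_one] at h

theorem jonesFun_mul (v w : ThompsonV) (a : LoopGroup Γ) :
    jonesFun α₀ α₁ (v * w) a = jonesFun α₀ α₁ v (jonesFun α₀ α₁ w a) := by
  ext y
  obtain ⟨x, rfl⟩ := (v * w).1.surjective y
  rw [jonesFun_apply, tau_mul]
  show _ = jonesFun α₀ α₁ v (jonesFun α₀ α₁ w a) (v.1 (w.1 x))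
  rw [jonesFun_apply, jonesFun_apply]
  rfl

/-- The Jones action `π : V → Aut(LΓ)`. -/
noncomputable def jonesAction : ThompsonV →* MulAut (LoopGroup Γ) where
  toFun v :=
    { toFun := jonesFun α₀ α₁ v
      invFun := jonesFun α₀ α₁ v⁻¹
      left_inv := fun a => by rw [← jonesFun_mul, inv_mul_cancel, jonesFun_one]
      right_inv := fun a => by rw [← jonesFun_mul, mul_inv_cancel, jonesFun_one]
      map_mul' := fun a b => by
        ext y
        exact map_mul (tau α₀ α₁ v (v.1.symm y)) _ _ }
  map_one' := by
    ext a x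
    exact congrArg (fun b : LoopGroup Γ => b x) (jonesFun_one α₀ α₁ a)
  map_mul' v w := by
    ext a x
    exact congrArg (fun b : LoopGroup Γ => b x) (jonesFun_mul α₀ α₁ v w a)

/-- The twisted fraction group `LΓ ⋊ V` of the triple `(Γ, α₀, α₁)`. -/
abbrev FractionGroup : Type _ := LoopGroup Γ ⋊[jonesAction α₀ α₁] ThompsonV

end Twist

/-!
Disjointness and inclusion of supports in `V` can be read off from commutation relations, so `V`
determines the Cantor space: every automorphism of `V` is conjugation by a homeomorphism (Rubin).
A homomorphism from `LΓ` to `V` with normal image sends the loops supported in two disjoint sets to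
commuting normal subgroups of its image. A nontrivial normal subgroup of `V` still acts minimally
and moves points inside every nonempty open set, so one of the two is trivial, and compression by
`V` makes the whole homomorphism trivial. Hence `θ` maps `LΓ` onto `LΓ'`, by an isomorphism `κ` that
intertwines the Jones actions up to a cocycle and up to the homeomorphism.

If `a x = 1`, then `κ a x` is central: some element of `V` fixes a neighbourhood of `x` and moves
the support of `a` off itself, so some conjugate of `κ a x` is the value at `x` of both `κ a₁` and
`κ a₂` for loops `a₁`, `a₂` with disjoint supports, and hence commutes with the values of all loops.
Central values transform under `V` without conjugation, so those of `κ a` extend to a unique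
invariant central loop `ζ a`. As every loop is a product of two loops which are trivial somewhere,
`ζ` extends to all of `LΓ`, and the value of `ζ⁻¹ κ` at a point depends only on the value of the
argument there.
-/

section RigidStabilizer

open MulAction
open scoped Pointwise commutatorElement

variable {G X : Type*} [Group G] [MulAction G X] {A B : Set X} {f g u : G} {x : X}

/-- The rigid stabilizer of `A`: the subgroup of the elements of `G` that fix every point outside
`A`. -/
def rigidStabilizer (G : Type*) {X : Type*} [Group G] [MulAction G X] (A : Set X) : Subgroup G :=
  fixingSubgroup G Aᶜ

theorem mem_rigidStabilizer_iff : g ∈ rigidStabilizer G A ↔ ∀ x ∉ A, g • x = x :=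
  mem_fixingSubgroup_iff G

theorem smul_eq_of_mem_rigidStabilizer (hg : g ∈ rigidStabilizer G A) (hx : x ∉ A) : g • x = x :=
  mem_rigidStabilizer_iff.1 hg x hx

theorem mem_of_smul_ne_of_mem_rigidStabilizer (hg : g ∈ rigidStabilizer G A) (hx : g • x ≠ x) :
    x ∈ A :=
  not_not.1 fun h => hx (smul_eq_of_mem_rigidStabilizer hg h)

theorem rigidStabilizer_mono (h : A ⊆ B) : rigidStabilizer G A ≤ rigidStabilizer G B :=
  fixingSubgroup_antitone G X (Set.compl_subset_compl.2 h)

theorem smul_mem_of_mem_rigidStabilizer (hg : g ∈ rigidStabilizer G A) (hx : x ∈ A) :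
    g • x ∈ A := by
  by_contra h
  rw [smul_left_cancel g (smul_eq_of_mem_rigidStabilizer hg h)] at h
  exact h hx

theorem conj_mem_rigidStabilizer (u : G) (hg : g ∈ rigidStabilizer G A) :
    u * g * u⁻¹ ∈ rigidStabilizer G (u • A) := by
  refine mem_rigidStabilizer_iff.2 fun x hx => ?_
  rw [Set.mem_smul_set_iff_inv_smul_mem] at hx
  rw [mul_smul, mul_smul, smul_eq_of_mem_rigidStabilizer hg hx, smul_inv_smul]

theorem commutatorElement_mem_rigidStabilizer_union (u : G) (hg : g ∈ rigidStabilizer G A) :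
    ⁅u, g⁆ ∈ rigidStabilizer G (A ∪ u • A) := by
  rw [commutatorElement_def]
  exact mul_mem (rigidStabilizer_mono Set.subset_union_right (conj_mem_rigidStabilizer u hg))
    (rigidStabilizer_mono Set.subset_union_left (inv_mem hg))

theorem mem_rigidStabilizer_compl_fixedBy (g : G) : g ∈ rigidStabilizer G (fixedBy X g)ᶜ :=
  mem_rigidStabilizer_iff.2 fun _ hx => not_not.1 hx

theorem commutatorElement_smul_of_disjoint_smul (hf : f ∈ rigidStabilizer G A)
    (hA : Disjoint A (u • A)) (hx : x ∈ A) : ⁅f, u⁆ • x = f • x := by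
  have h := conj_mem_rigidStabilizer u (inv_mem hf)
  rw [commutatorElement_def, mul_assoc, mul_assoc, ← mul_assoc u, mul_smul,
    smul_eq_of_mem_rigidStabilizer h (Set.disjoint_left.1 hA hx)]

theorem commutatorElement_mem_of_right_mem {N : Subgroup G} [N.Normal] (f : G) (hu : u ∈ N) :
    ⁅f, u⁆ ∈ N :=
  Subgroup.commutator_le_right ⊤ N (Subgroup.commutator_mem_commutator (Subgroup.mem_top f) hu)

theorem mul_pow_succ_smul_of_disjoint {W : Set X} {k : G} (hk : k ∈ rigidStabilizer G W) {n : ℕ}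
    (hd : ∀ i ∈ Set.Icc 1 n, Disjoint W (g ^ i • W)) (hx : x ∈ W) {i : ℕ} (hi : i ≤ n) :
    (g * k) ^ (i + 1) • x = g ^ (i + 1) • k • x := by
  induction i with
  | zero => rw [zero_add, pow_one, pow_one, mul_smul]
  | succ i ih =>
    have hmem : g ^ (i + 1) • k • x ∈ g ^ (i + 1) • W :=
      Set.smul_mem_smul_set (smul_mem_of_mem_rigidStabilizer hk hx)
    rw [pow_succ', mul_smul, ih (by omega), mul_smul, smul_eq_of_mem_rigidStabilizer hk
      (Set.disjoint_right.1 (hd (i + 1) ⟨by omega, hi⟩) hmem), pow_succ' g (i + 1), mul_smul]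

section Faithful

variable [FaithfulSMul G X]

theorem exists_smul_ne_of_ne_one (hg : g ≠ 1) : ∃ x : X, g • x ≠ x := by
  by_contra! h
  exact hg (eq_of_smul_eq_smul (α := X) fun x => by rw [h, one_smul])

theorem commute_of_disjoint_of_mem_rigidStabilizer (hf : f ∈ rigidStabilizer G A)
    (hg : g ∈ rigidStabilizer G B) (h : Disjoint A B) : Commute f g := by
  refine eq_of_smul_eq_smul (α := X) fun x => ?_
  by_cases hx : x ∈ A
  · rw [mul_smul, mul_smul, smul_eq_of_mem_rigidStabilizer hg (Set.disjoint_left.1 h hx),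
      smul_eq_of_mem_rigidStabilizer hg
        (Set.disjoint_left.1 h (smul_mem_of_mem_rigidStabilizer hf hx))]
  · by_cases hxB : x ∈ B
    · rw [mul_smul, mul_smul, smul_eq_of_mem_rigidStabilizer hf hx,
        smul_eq_of_mem_rigidStabilizer hf
          (Set.disjoint_right.1 h (smul_mem_of_mem_rigidStabilizer hg hxB))]
    · rw [mul_smul, mul_smul, smul_eq_of_mem_rigidStabilizer hf hx,
        smul_eq_of_mem_rigidStabilizer hg hxB, smul_eq_of_mem_rigidStabilizer hf hx]

theorem commutatorElement_commutatorElement_of_disjoint_smul (hf : f ∈ rigidStabilizer G A)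
    (hg : g ∈ rigidStabilizer G A) (hA : Disjoint A (u • A)) : ⁅f, ⁅g, u⁆⁆ = ⁅f, g⁆ := by
  have h : Commute f (u * g⁻¹ * u⁻¹) := commute_of_disjoint_of_mem_rigidStabilizer hf
    (conj_mem_rigidStabilizer u (inv_mem hg)) hA
  have hgu : ⁅g, u⁆ = g * (u * g⁻¹ * u⁻¹) := by rw [commutatorElement_def]; group
  rw [hgu]
  generalize u * g⁻¹ * u⁻¹ = k at h
  calc ⁅f, g * k⁆ = f * g * (k * f⁻¹ * k⁻¹) * g⁻¹ := by rw [commutatorElement_def]; group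
    _ = ⁅f, g⁆ := by rw [h.inv_left.symm.eq, mul_inv_cancel_right, commutatorElement_def]

theorem exists_smul_ne_and_smul_ne_of_not_commute (h : ¬Commute f g) :
    ∃ x : X, f • x ≠ x ∧ g • x ≠ x := by
  by_contra! hfg
  exact h (commute_of_disjoint_of_mem_rigidStabilizer
    (mem_rigidStabilizer_compl_fixedBy (X := X) f)
    (mem_rigidStabilizer_iff.2 fun x hx => hfg x hx) disjoint_compl_left)

end Faithful

variable [TopologicalSpace X]

theorem exists_mem_normal_smul_ne [FaithfulSMul G X] [IsMinimal G X] {N : Subgroup G}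
    [hN : N.Normal] (hN1 : N ≠ ⊥) {U : Set X} (hU : IsOpen U) (hU' : U.Nonempty) :
    ∃ u ∈ N, ∃ x ∈ U, u • x ≠ x := by
  obtain ⟨u, hu, hu1⟩ := N.bot_or_exists_ne_one.resolve_left hN1
  obtain ⟨y, hy⟩ := exists_smul_ne_of_ne_one (X := X) hu1
  obtain ⟨g, hg⟩ := hU.exists_smul_mem G y hU'
  exact ⟨g * u * g⁻¹, hN.conj_mem u hu g, g • y, hg, by
    rwa [mul_smul, inv_smul_smul, mul_smul, Ne, smul_left_cancel_iff]⟩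

variable [T2Space X] [ContinuousConstSMul G X]

theorem exists_isOpen_disjoint_smul {W : Set X} (hW : IsOpen W) (hxW : x ∈ W) (hx : g • x ≠ x) :
    ∃ U, IsOpen U ∧ x ∈ U ∧ U ⊆ W ∧ Disjoint U (g • U) := by
  obtain ⟨U₁, U₂, hU₁, hU₂, h₁, h₂, hd⟩ := t2_separation hx
  refine ⟨W ∩ (U₂ ∩ (g • ·) ⁻¹' U₁), hW.inter (hU₂.inter (hU₁.preimage (continuous_const_smul g))),
    ⟨hxW, h₂, h₁⟩, Set.inter_subset_left, ?_⟩
  rw [Set.disjoint_right]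
  rintro _ ⟨y, hy, rfl⟩ hgy
  exact Set.disjoint_left.1 hd hy.2.2 hgy.2.1

theorem exists_isOpen_disjoint_pow_smul {W : Set X} (hW : IsOpen W) (hxW : x ∈ W) {n : ℕ}
    (hx : ∀ i ∈ Set.Icc 1 n, g ^ i • x ≠ x) :
    ∃ U, IsOpen U ∧ x ∈ U ∧ U ⊆ W ∧ ∀ i ∈ Set.Icc 1 n, Disjoint U (g ^ i • U) := by
  choose! V hV hxV _ hVd using fun i hi => exists_isOpen_disjoint_smul hW hxW (hx i hi)
  refine ⟨W ∩ ⋂ i ∈ Set.Icc 1 n, V i, hW.inter ((Set.finite_Icc 1 n).isOpen_biInter hV),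
    ⟨hxW, Set.mem_iInter₂.2 hxV⟩, Set.inter_subset_left, fun i hi => ?_⟩
  have hsub : W ∩ ⋂ i ∈ Set.Icc 1 n, V i ⊆ V i :=
    Set.inter_subset_right.trans (Set.biInter_subset_of_mem hi)
  exact (hVd i hi).mono hsub (Set.smul_set_mono hsub)

theorem isOpen_compl_fixedBy (g : G) : IsOpen (fixedBy X g)ᶜ :=
  (isClosed_eq (continuous_const_smul g) continuous_id).isOpen_compl

end RigidStabilizer

section LocallyMoving

open MulAction
open scoped Pointwise commutatorElement

variable {G X : Type*} [Group G] [MulAction G X] [TopologicalSpace X]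

/-- An action is locally moving if every nonempty open set has a nontrivial rigid stabilizer. -/
def IsLocallyMoving (G X : Type*) [Group G] [MulAction G X] [TopologicalSpace X] : Prop :=
  ∀ U : Set X, IsOpen U → U.Nonempty → ∃ g ∈ rigidStabilizer G U, g ≠ 1

namespace IsLocallyMoving

variable [FaithfulSMul G X] {U : Set X}

theorem exists_smul_ne (h : IsLocallyMoving G X) (hU : IsOpen U) (hU' : U.Nonempty) :
    ∃ g ∈ rigidStabilizer G U, ∃ x ∈ U, g • x ≠ x := by
  obtain ⟨g, hg, hg1⟩ := h U hU hU'
  obtain ⟨x, hx⟩ := exists_smul_ne_of_ne_one (X := X) hg1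
  exact ⟨g, hg, x, mem_of_smul_ne_of_mem_rigidStabilizer hg hx, hx⟩

variable [T2Space X] [ContinuousConstSMul G X]

theorem exists_commutatorElement_ne_one (h : IsLocallyMoving G X) (hU : IsOpen U)
    (hU' : U.Nonempty) : ∃ f ∈ rigidStabilizer G U, ∃ g ∈ rigidStabilizer G U, ⁅f, g⁆ ≠ 1 := by
  obtain ⟨g, hg, x, hxU, hx⟩ := h.exists_smul_ne hU hU'
  obtain ⟨W, hW, hxW, hWU, hd⟩ := exists_isOpen_disjoint_smul hU hxU hx
  obtain ⟨f, hf, y, hyW, hy⟩ := h.exists_smul_ne hW ⟨x, hxW⟩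
  refine ⟨f, rigidStabilizer_mono hWU hf, g, hg, fun h1 => hy ?_⟩
  rw [← commutatorElement_smul_of_disjoint_smul hf hd hyW, h1, one_smul]

theorem exists_pow_smul_ne (h : IsLocallyMoving G X) (hU : IsOpen U) (hU' : U.Nonempty) (n : ℕ) :
    ∃ g ∈ rigidStabilizer G U, ∃ x ∈ U, ∀ i ∈ Set.Icc 1 n, g ^ i • x ≠ x := by
  induction n with
  | zero => exact ⟨1, one_mem _, hU'.some, hU'.some_mem, fun i hi => by grind⟩
  | succ n ih =>
    obtain ⟨g, hg, x, hxU, hx⟩ := ih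
    obtain ⟨W, hW, hxW, hWU, hd⟩ := exists_isOpen_disjoint_pow_smul hU hxU hx
    have hret : ∀ i ∈ Set.Icc 1 n, ∀ y ∈ W, ∀ z ∈ W, g ^ i • y ≠ z := fun i hi y hy z hz hyz =>
      Set.disjoint_left.1 (hd i hi) hz ⟨y, hy, hyz⟩
    by_cases hfix : ∀ y ∈ W, g ^ (n + 1) • y = y
    · -- If `g ^ (n + 1)` is trivial on `W`, then the return map of `g * k` to `W` is that of `k`.
      obtain ⟨k, hk, y, hyW, hy⟩ := h.exists_smul_ne hW ⟨x, hxW⟩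
      have hkW : k • y ∈ W := smul_mem_of_mem_rigidStabilizer hk hyW
      refine ⟨g * k, mul_mem hg (rigidStabilizer_mono hWU hk), y, hWU hyW, fun i hi => ?_⟩
      obtain ⟨j, rfl⟩ := Nat.exists_eq_add_of_le' hi.1
      rw [mul_pow_succ_smul_of_disjoint hk hd hyW (Nat.succ_le_succ_iff.1 hi.2)]
      rcases hi.2.lt_or_eq with hlt | heq
      · exact hret _ ⟨hi.1, Nat.lt_succ_iff.1 hlt⟩ _ hkW _ hyW
      · rwa [heq, hfix _ hkW]
    · push Not at hfix
      obtain ⟨y, hyW, hy⟩ := hfix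
      refine ⟨g, hg, y, hWU hyW, fun i hi => ?_⟩
      rcases hi.2.lt_or_eq with hlt | rfl
      · exact hret i ⟨hi.1, Nat.lt_succ_iff.1 hlt⟩ y hyW y hyW
      · exact hy

variable [IsMinimal G X]

theorem subgroup_of_normal (h : IsLocallyMoving G X) {N : Subgroup G} [N.Normal] (hN : N ≠ ⊥) :
    IsLocallyMoving N X := by
  intro U hU hU'
  obtain ⟨u, hu, x, hxU, hx⟩ := exists_mem_normal_smul_ne hN hU hU'
  obtain ⟨J, hJ, hxJ, hJU, hd⟩ := exists_isOpen_disjoint_smul hU hxU hx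
  obtain ⟨f, hf, g, hg, hfg⟩ := h.exists_commutatorElement_ne_one hJ ⟨x, hxJ⟩
  have hmem : ⁅f, g⁆ ∈ N := by
    rw [← commutatorElement_commutatorElement_of_disjoint_smul hf hg hd]
    exact commutatorElement_mem_of_right_mem f (commutatorElement_mem_of_right_mem g hu)
  have hrist : ⁅f, g⁆ ∈ rigidStabilizer G U := rigidStabilizer_mono hJU <|
    Subgroup.commutator_le_self _ (Subgroup.commutator_mem_commutator hf hg)
  exact ⟨⟨_, hmem⟩, mem_rigidStabilizer_iff.2 fun y hy => smul_eq_of_mem_rigidStabilizer hrist hy,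
    fun h1 => hfg (congrArg Subtype.val h1)⟩

theorem eq_bot_or_eq_bot_of_commute (h : IsLocallyMoving G X) {A B : Subgroup G} [A.Normal]
    [B.Normal] (hAB : ∀ a ∈ A, ∀ b ∈ B, Commute a b) : A = ⊥ ∨ B = ⊥ := by
  by_contra! hne
  obtain ⟨b, hb, hb1⟩ := B.bot_or_exists_ne_one.resolve_left hne.2
  obtain ⟨a, ha, x, hbx, hax⟩ :=
    exists_mem_normal_smul_ne hne.1 (isOpen_compl_fixedBy (X := X) b) (exists_smul_ne_of_ne_one hb1)
  obtain ⟨J₁, hJ₁, hxJ₁, -, hd₁⟩ := exists_isOpen_disjoint_smul isOpen_univ (Set.mem_univ x) hax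
  obtain ⟨J, hJ, hxJ, hJJ₁, hdb⟩ := exists_isOpen_disjoint_smul hJ₁ hxJ₁ hbx
  have hda : Disjoint J (a • J) := hd₁.mono hJJ₁ (Set.smul_set_mono hJJ₁)
  obtain ⟨f, hf, g, hg, hfg⟩ := h.exists_commutatorElement_ne_one hJ ⟨x, hxJ⟩
  refine hfg (commutatorElement_eq_one_iff_mul_comm.2 (eq_of_smul_eq_smul (α := X) fun y => ?_))
  by_cases hy : y ∈ J
  · have hcomm : Commute ⁅f, a⁆ ⁅g, b⁆ := hAB _ (commutatorElement_mem_of_right_mem f ha) _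
      (commutatorElement_mem_of_right_mem g hb)
    have hfJ : ∀ z ∈ J, ⁅f, a⁆ • z = f • z := fun z =>
      commutatorElement_smul_of_disjoint_smul hf hda
    have hgJ : ∀ z ∈ J, ⁅g, b⁆ • z = g • z := fun z =>
      commutatorElement_smul_of_disjoint_smul hg hdb
    rw [mul_smul, mul_smul, ← hgJ y hy, ← hfJ y hy,
      ← hfJ _ ((hgJ y hy).symm ▸ smul_mem_of_mem_rigidStabilizer hg hy),
      ← hgJ _ ((hfJ y hy).symm ▸ smul_mem_of_mem_rigidStabilizer hf hy), ← mul_smul, ← mul_smul,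
      hcomm.eq]
  · rw [mul_smul, mul_smul, smul_eq_of_mem_rigidStabilizer hg hy,
      smul_eq_of_mem_rigidStabilizer hf hy, smul_eq_of_mem_rigidStabilizer hg hy]

end IsLocallyMoving

end LocallyMoving

section AlgebraicDisjointness

open MulAction
open scoped Pointwise commutatorElement

section Group

variable {G H : Type*} [Group G] [Group H]

/-- Rubin's algebraic disjointness: a first-order condition on group elements which, for locally
moving actions, approximates the disjointness of the sets of points moved by `f` and `g`. -/
def AlgDisjoint (f g : G) : Prop :=
  ∀ h, ¬Commute f h → ∃ f₁ f₂, Commute f₁ g ∧ Commute f₂ g ∧ ⁅f₁, ⁅f₂, h⁆⁆ ≠ 1 ∧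
    Commute ⁅f₁, ⁅f₂, h⁆⁆ g

theorem AlgDisjoint.map {f g : G} (h : AlgDisjoint f g) (ψ : G ≃* H) :
    AlgDisjoint (ψ f) (ψ g) := by
  intro k hk
  obtain ⟨k, rfl⟩ := ψ.surjective k
  obtain ⟨f₁, f₂, h₁, h₂, hne, hcomm⟩ := h k fun hc => hk (hc.map ψ)
  refine ⟨ψ f₁, ψ f₂, h₁.map ψ, h₂.map ψ, ?_, ?_⟩
  · rwa [← map_commutatorElement, ← map_commutatorElement, map_ne_one_iff ψ ψ.injective]
  · rw [← map_commutatorElement, ← map_commutatorElement]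
    exact hcomm.map ψ

theorem algDisjoint_map_iff {f g : G} (ψ : G ≃* H) :
    AlgDisjoint (ψ f) (ψ g) ↔ AlgDisjoint f g :=
  ⟨fun h => by simpa only [ψ.symm_apply_apply] using h.map ψ.symm, fun h => h.map ψ⟩

end Group

variable {G X : Type*} [Group G] [MulAction G X] {f g : G} {A : Set X} {x : X}

theorem exists_mem_smul_of_commutatorElement_commutatorElement_smul_ne {f₁ f₂ h : G}
    (hh : h ∈ rigidStabilizer G A) (hx : ⁅f₁, ⁅f₂, h⁆⁆ • x ≠ x) :
    ∃ e, (e = 1 ∨ e = f₂ ∨ e = f₁ ∨ e = f₁ * f₂) ∧ x ∈ e • A := by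
  have h₂ := commutatorElement_mem_rigidStabilizer_union f₂ hh
  have hxA := mem_of_smul_ne_of_mem_rigidStabilizer
    (commutatorElement_mem_rigidStabilizer_union f₁ h₂) hx
  rw [Set.smul_set_union, smul_smul] at hxA
  rcases hxA with (h | h) | h | h
  · exact ⟨1, by simp, by rwa [one_smul]⟩
  · exact ⟨f₂, by simp, h⟩
  · exact ⟨f₁, by simp, h⟩
  · exact ⟨f₁ * f₂, by simp, h⟩

theorem eq_of_mem_smul_of_commute {e : G} {n : ℕ} {z : X} (he : Commute e g)
    (hd : ∀ i ∈ Set.Icc 1 n, Disjoint A (g ^ i • A)) {i j : ℕ} (hi : i ≤ n) (hj : j ≤ n)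
    (hzi : g ^ i • z ∈ e • A) (hzj : g ^ j • z ∈ e • A) : i = j := by
  wlog hij : i ≤ j generalizing i j
  · exact (this hj hi hzj hzi (le_of_not_ge hij)).symm
  by_contra hne
  obtain ⟨k, rfl⟩ := Nat.exists_eq_add_of_le' hij
  rw [Set.mem_smul_set_iff_inv_smul_mem] at hzi hzj
  refine Set.disjoint_left.1 (hd k ⟨by omega, by omega⟩) hzj ⟨_, hzi, ?_⟩
  beta_reduce
  rw [smul_smul, smul_smul, (he.inv_left.pow_right k).symm.eq, mul_assoc, ← pow_add]
  rw [smul_smul]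

/-- The exponent `12` is chosen as the least common multiple of `1, 2, 3, 4`, so that `x` has at
least five translates by powers of `g`. -/
theorem pow_smul_ne_of_pow_twelve_smul_ne (hx : g ^ 12 • x ≠ x) {i : ℕ} (hi : i ∈ Set.Icc 1 4) :
    g ^ i • x ≠ x := by
  intro hix
  rw [Ne, pow_smul_eq_iff_period_dvd] at hx
  rw [pow_smul_eq_iff_period_dvd] at hix
  have hi12 : i ∣ 12 := by obtain ⟨h1, h4⟩ := hi; interval_cases i <;> decide
  exact hx (hix.trans hi12)

variable [TopologicalSpace X] [FaithfulSMul G X] [T2Space X] [ContinuousConstSMul G X]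

theorem AlgDisjoint.pow_smul_eq (h : AlgDisjoint f g) (hG : IsLocallyMoving G X)
    (hx : f • x ≠ x) : g ^ 12 • x = x := by
  classical
  by_contra hgx
  obtain ⟨J₁, hJ₁, hxJ₁, -, hd₁⟩ := exists_isOpen_disjoint_pow_smul isOpen_univ
    (Set.mem_univ x) fun i => pow_smul_ne_of_pow_twelve_smul_ne hgx
  obtain ⟨J, hJ, hxJ, hJJ₁, hdf⟩ := exists_isOpen_disjoint_smul hJ₁ hxJ₁ hx
  have hd : ∀ i ∈ Set.Icc 1 4, Disjoint J (g ^ i • J) := fun i hi =>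
    (hd₁ i hi).mono hJJ₁ (Set.smul_set_mono hJJ₁)
  obtain ⟨k, hk, y, hyJ, hy⟩ := hG.exists_smul_ne hJ ⟨x, hxJ⟩
  have hfk : ¬Commute f k := fun hc => hy <| by
    rw [← commutatorElement_smul_of_disjoint_smul hk hdf hyJ,
      commutatorElement_eq_one_iff_mul_comm.2 hc.symm.eq, one_smul]
  obtain ⟨f₁, f₂, h₁, h₂, hne, hcomm⟩ := h k hfk
  obtain ⟨z, hz⟩ := exists_smul_ne_of_ne_one (X := X) hne
  have hmoved : ∀ i, ⁅f₁, ⁅f₂, k⁆⁆ • g ^ i • z ≠ g ^ i • z := fun i => by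
    rwa [← mul_smul, (hcomm.pow_right i).eq, mul_smul, Ne, smul_left_cancel_iff]
  choose e he hze using fun i =>
    exists_mem_smul_of_commutatorElement_commutatorElement_smul_ne hk (hmoved i)
  have heg : ∀ i, Commute (e i) g := fun i => by
    rcases he i with h | h | h | h <;> rw [h]
    exacts [Commute.one_left g, h₂, h₁, h₁.mul_left h₂]
  obtain ⟨i, hi, j, hj, hij, heij⟩ := Finset.exists_ne_map_eq_of_card_lt_of_maps_to
    (s := Finset.range 5) (t := {1, f₂, f₁, f₁ * f₂}) (f := e)
    (Finset.card_le_four.trans_lt (by simp)) fun i _ => by simpa using he i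
  exact hij (eq_of_mem_smul_of_commute (heg i) hd (Finset.mem_range_succ_iff.1 hi)
    (Finset.mem_range_succ_iff.1 hj) (hze i) (heij ▸ hze j))

theorem IsLocallyMoving.algDisjoint (hG : IsLocallyMoving G X)
    (hfg : Disjoint (fixedBy X f)ᶜ (fixedBy X g)ᶜ) : AlgDisjoint f g := by
  intro h hfh
  obtain ⟨x, hfx, hhx⟩ := exists_smul_ne_and_smul_ne_of_not_commute (X := X) hfh
  obtain ⟨J, hJ, hxJ, hJf, hd⟩ := exists_isOpen_disjoint_smul (isOpen_compl_fixedBy f) hfx hhx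
  obtain ⟨f₁, hf₁, f₂, hf₂, hne⟩ := hG.exists_commutatorElement_ne_one hJ ⟨x, hxJ⟩
  have hcomm : ∀ k ∈ rigidStabilizer G J, Commute k g := fun k hk =>
    commute_of_disjoint_of_mem_rigidStabilizer (rigidStabilizer_mono hJf hk)
      (mem_rigidStabilizer_compl_fixedBy g) hfg
  have heq : ⁅f₁, ⁅f₂, h⁆⁆ = ⁅f₁, f₂⁆ :=
    commutatorElement_commutatorElement_of_disjoint_smul hf₁ hf₂ hd
  refine ⟨f₁, f₂, hcomm f₁ hf₁, hcomm f₂ hf₂, heq ▸ hne, heq ▸ hcomm _ ?_⟩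
  exact Subgroup.commutator_le_self _ (Subgroup.commutator_mem_commutator hf₁ hf₂)

end AlgebraicDisjointness

section Support

open MulAction
open scoped Pointwise

variable {G X : Type*} [Group G] [MulAction G X] [TopologicalSpace X]

/-- The support of `g`: the closure of the set of points moved by `g`. -/
def smulSupport (X : Type*) {G : Type*} [Group G] [MulAction G X] [TopologicalSpace X] (g : G) :
    Set X :=
  closure (fixedBy X g)ᶜ

theorem smul_smulSupport [ContinuousConstSMul G X] (k g : G) :
    k • smulSupport X g = smulSupport X (k * g * k⁻¹) := by
  rw [smulSupport, ← closure_smul, Set.smul_set_compl, smul_fixedBy, smulSupport]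

variable [FaithfulSMul G X]

theorem smulSupport_nonempty_iff {g : G} : (smulSupport X g).Nonempty ↔ g ≠ 1 := by
  rw [smulSupport, closure_nonempty_iff, Set.nonempty_compl, Ne, fixedBy_eq_univ_iff_eq_one]

variable [T2Space X] [ContinuousConstSMul G X] {f h : G}

theorem smulSupport_subset_iff (hG : IsLocallyMoving G X) :
    smulSupport X f ⊆ smulSupport X h ↔ ∀ g, AlgDisjoint h g → Commute f (g ^ 12) := by
  constructor
  · intro hfh g hg
    have hd : Disjoint (smulSupport X h) (fixedBy X (g ^ 12))ᶜ :=
      Disjoint.closure_left (Set.disjoint_left.2 fun x hx hgx => hgx (hg.pow_smul_eq hG hx))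
        (isOpen_compl_fixedBy _)
    exact commute_of_disjoint_of_mem_rigidStabilizer (mem_rigidStabilizer_compl_fixedBy f)
      (mem_rigidStabilizer_compl_fixedBy _) (hd.mono_left (subset_closure.trans hfh))
  · intro hfh
    refine closure_minimal (fun x hfx => ?_) isClosed_closure
    by_contra hx
    obtain ⟨J, hJ, hxJ, hJh, hd⟩ :=
      exists_isOpen_disjoint_smul (isClosed_closure (s := (fixedBy X h)ᶜ)).isOpen_compl hx hfx
    obtain ⟨g, hg, y, hyJ, hy⟩ := hG.exists_pow_smul_ne hJ ⟨x, hxJ⟩ 12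
    have hhg : AlgDisjoint h g := hG.algDisjoint <| Set.disjoint_left.2 fun z hz hgz =>
      hJh (mem_of_smul_ne_of_mem_rigidStabilizer hg hgz) (subset_closure hz)
    apply hy 12 ⟨by norm_num, le_rfl⟩
    rw [← commutatorElement_smul_of_disjoint_smul (pow_mem hg 12) hd hyJ,
      commutatorElement_eq_one_iff_mul_comm.2 (hfh g hhg).symm.eq, one_smul]

end Support

section Rubin

open MulAction

/-- An action has clopen supports if the support of every group element is open and every
neighbourhood of a point `x` contains the support of a group element with `x` in its support. -/
class HasClopenSupports (G X : Type*) [Group G] [MulAction G X] [TopologicalSpace X] : Prop where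
  isOpen_smulSupport (g : G) : IsOpen (smulSupport X g)
  exists_smulSupport_subset {U : Set X} (hU : IsOpen U) {x : X} (hx : x ∈ U) :
    ∃ g : G, x ∈ smulSupport X g ∧ smulSupport X g ⊆ U

open HasClopenSupports

section Action

variable (G X : Type*) [Group G] [MulAction G X] [TopologicalSpace X] [FaithfulSMul G X]
  [HasClopenSupports G X]

theorem HasClopenSupports.isLocallyMoving : IsLocallyMoving G X := by
  rintro U hU ⟨x, hx⟩
  obtain ⟨g, hxg, hgU⟩ := exists_smulSupport_subset (G := G) hU hx
  exact ⟨g, rigidStabilizer_mono (subset_closure.trans hgU) (mem_rigidStabilizer_compl_fixedBy g),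
    smulSupport_nonempty_iff.1 ⟨x, hxg⟩⟩

end Action

variable {G H X Y : Type*} [Group G] [Group H] [MulAction G X] [MulAction H Y]
  [TopologicalSpace X] [TopologicalSpace Y]

/-- The points `x` and `y` correspond under the group isomorphism `ψ` if `ψ` matches the elements
with `x` in their support and those with `y` in their support. -/
def PointCorr (ψ : G ≃* H) (x : X) (y : Y) : Prop :=
  ∀ g, x ∈ smulSupport X g ↔ y ∈ smulSupport Y (ψ g)

namespace PointCorr

variable {ψ : G ≃* H} {x x' : X} {y y' : Y}

theorem symm (h : PointCorr ψ x y) : PointCorr ψ.symm y x := fun k => by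
  rw [h, ψ.apply_symm_apply]

theorem smul [ContinuousConstSMul G X] [ContinuousConstSMul H Y] (h : PointCorr ψ x y) (g : G) :
    PointCorr ψ (g • x) (ψ g • y) := fun k => by
  rw [← Set.mem_inv_smul_set_iff, ← Set.mem_inv_smul_set_iff, smul_smulSupport, smul_smulSupport,
    h, map_mul, map_mul, inv_inv, inv_inv, map_inv]

theorem right_unique [T1Space Y] [HasClopenSupports H Y] (h : PointCorr ψ x y)
    (h' : PointCorr ψ x y') : y = y' := by
  by_contra hne
  obtain ⟨k, hyk, hk⟩ := exists_smulSupport_subset (G := H) isOpen_compl_singleton hne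
  obtain ⟨g, rfl⟩ := ψ.surjective k
  exact hk ((h' g).1 ((h g).2 hyk)) rfl

theorem continuous [HasClopenSupports G X] [HasClopenSupports H Y] {φ : X → Y}
    (h : ∀ x, PointCorr ψ x (φ x)) : Continuous φ := by
  refine continuous_iff_continuousAt.2 fun x U hU => ?_
  obtain ⟨k, hxk, hk⟩ := exists_smulSupport_subset (G := H) isOpen_interior
    (mem_interior_iff_mem_nhds.2 hU)
  obtain ⟨g, rfl⟩ := ψ.surjective k
  exact Filter.mem_map.2 (Filter.mem_of_superset ((isOpen_smulSupport g).mem_nhds ((h x g).2 hxk))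
    fun x' hx' => Set.mem_preimage.2 (interior_subset (hk ((h x' g).1 hx'))))

end PointCorr

variable [FaithfulSMul G X] [T2Space X] [ContinuousConstSMul G X] [HasClopenSupports G X]
  [FaithfulSMul H Y] [T2Space Y] [ContinuousConstSMul H Y] [HasClopenSupports H Y]

variable (X Y) in
theorem smulSupport_map_subset_iff (ψ : G ≃* H) {f h : G} :
    smulSupport Y (ψ f) ⊆ smulSupport Y (ψ h) ↔ smulSupport X f ⊆ smulSupport X h := by
  rw [smulSupport_subset_iff (isLocallyMoving H Y), smulSupport_subset_iff (isLocallyMoving G X),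
    ψ.surjective.forall]
  simp only [algDisjoint_map_iff, ← map_pow, commute_map_iff ψ.injective]

theorem disjoint_smulSupport_map (ψ : G ≃* H) {f h : G}
    (hd : Disjoint (smulSupport X f) (smulSupport X h)) :
    Disjoint (smulSupport Y (ψ f)) (smulSupport Y (ψ h)) := by
  refine Set.disjoint_left.2 fun y hf hh => ?_
  obtain ⟨k, hyk, hk⟩ := exists_smulSupport_subset (G := H)
    ((isOpen_smulSupport (ψ f)).inter (isOpen_smulSupport (ψ h))) ⟨hf, hh⟩
  obtain ⟨g, rfl⟩ := ψ.surjective k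
  rw [Set.subset_inter_iff, smulSupport_map_subset_iff X Y, smulSupport_map_subset_iff X Y] at hk
  have hg : g ≠ 1 := fun h1 => smulSupport_nonempty_iff.1 ⟨y, hyk⟩ (by rw [h1, map_one])
  obtain ⟨x, hx⟩ := smulSupport_nonempty_iff (X := X).2 hg
  exact Set.disjoint_left.1 hd (hk.1 hx) (hk.2 hx)

theorem exists_pointCorr [CompactSpace Y] (ψ : G ≃* H) (x : X) : ∃ y : Y, PointCorr ψ x y := by
  have hne : (⋂ g : {g : G // x ∈ smulSupport X g}, smulSupport Y (ψ g)).Nonempty := by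
    have : Nonempty {g : G // x ∈ smulSupport X g} :=
      let ⟨g, hg, _⟩ := exists_smulSupport_subset (G := G) isOpen_univ (Set.mem_univ x)
      ⟨⟨g, hg⟩⟩
    refine IsCompact.nonempty_iInter_of_directed_nonempty_isCompact_isClosed _ ?_ ?_
      (fun _ => isClosed_closure.isCompact) fun _ => isClosed_closure
    · rintro ⟨g, hg⟩ ⟨h, hh⟩
      obtain ⟨k, hk, hkgh⟩ := exists_smulSupport_subset (G := G)
        ((isOpen_smulSupport g).inter (isOpen_smulSupport h)) ⟨hg, hh⟩
      obtain ⟨hkg, hkh⟩ := Set.subset_inter_iff.1 hkgh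
      exact ⟨⟨k, hk⟩, (smulSupport_map_subset_iff X Y ψ).2 hkg,
        (smulSupport_map_subset_iff X Y ψ).2 hkh⟩
    · rintro ⟨g, hg⟩
      have hg1 : g ≠ 1 := smulSupport_nonempty_iff.1 ⟨x, hg⟩
      exact smulSupport_nonempty_iff.2 ((map_ne_one_iff ψ ψ.injective).2 hg1)
  obtain ⟨y, hy⟩ := hne
  have hmap : ∀ g, x ∈ smulSupport X g → y ∈ smulSupport Y (ψ g) := fun g hg =>
    Set.mem_iInter.1 hy ⟨g, hg⟩
  refine ⟨y, fun g => ⟨hmap g, fun hyg => ?_⟩⟩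
  by_contra hxg
  obtain ⟨k, hxk, hk⟩ := exists_smulSupport_subset (G := G)
    (isClosed_closure (s := (fixedBy X g)ᶜ)).isOpen_compl hxg
  exact Set.disjoint_left.1 (disjoint_smulSupport_map ψ (Set.subset_compl_iff_disjoint_right.1 hk))
    (hmap k hxk) hyg

theorem exists_homeomorph_of_mulEquiv [CompactSpace X] [CompactSpace Y] (ψ : G ≃* H) :
    ∃ φ : X ≃ₜ Y, ∀ (g : G) (x : X), φ (g • x) = ψ g • φ x := by
  choose φ hφ using exists_pointCorr (X := X) (Y := Y) ψ
  choose φ' hφ' using exists_pointCorr (X := Y) (Y := X) ψ.symm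
  refine ⟨⟨⟨φ, φ', fun x => (hφ' (φ x)).right_unique (hφ x).symm,
    fun y => (hφ (φ' y)).right_unique (hφ' y).symm⟩, PointCorr.continuous hφ,
    PointCorr.continuous hφ'⟩, fun g x => (hφ (g • x)).right_unique ((hφ x).smul g)⟩

end Rubin

section Flexible

open MulAction
open scoped Pointwise commutatorElement Topology

/-- An action by homeomorphisms is flexible if proper closed sets can be compressed into every
nonempty open set, and if the germ of a group element that moves a point inside an open set `W` is
also the germ of a group element supported in `W`. -/
class IsFlexible (G X : Type*) [Group G] [MulAction G X] [TopologicalSpace X] : Prop where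
  exists_smul_subset {F U : Set X} (hF : IsClosed F) (hF' : F ≠ Set.univ) (hU : IsOpen U)
    (hU' : U.Nonempty) : ∃ g : G, g • F ⊆ U
  exists_germ_of_smul_ne {W : Set X} (hW : IsOpen W) {x : X} (hx : x ∈ W) {g : G}
    (hgx : g • x ∈ W) (hne : g • x ≠ x) : ∃ v ∈ rigidStabilizer G W, ∀ᶠ y in 𝓝 x, v • y = g • y

namespace IsFlexible

variable {G X : Type*} [Group G] [MulAction G X] [TopologicalSpace X] [IsFlexible G X] [T2Space X]

theorem exists_mem_normal_disjoint_smul [FaithfulSMul G X] [ContinuousConstSMul G X]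
    {N : Subgroup G} [hN : N.Normal] (hN1 : N ≠ ⊥) {F : Set X} (hF : IsClosed F)
    (hF' : F ≠ Set.univ) : ∃ s ∈ N, Disjoint F (s • F) := by
  obtain ⟨u, hu, hu1⟩ := N.bot_or_exists_ne_one.resolve_left hN1
  obtain ⟨y, hy⟩ := exists_smul_ne_of_ne_one (X := X) hu1
  obtain ⟨U, hU, hyU, -, hd⟩ := exists_isOpen_disjoint_smul isOpen_univ (Set.mem_univ y) hy
  obtain ⟨g, hg⟩ := exists_smul_subset (G := G) hF hF' hU ⟨y, hyU⟩
  refine ⟨g⁻¹ * u * g, by simpa using hN.conj_mem u hu g⁻¹, ?_⟩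
  rw [← Set.disjoint_smul_set (a := g), smul_smul, mul_assoc, mul_inv_cancel_left, mul_smul]
  exact hd.mono hg (Set.smul_set_mono hg)

variable [PerfectSpace X]

instance : IsMinimal G X where
  dense_orbit x := by
    refine dense_iff_inter_open.2 fun U hU hU' => ?_
    have : Infinite X := Set.infinite_univ_iff.1 (infinite_of_mem_nhds x Filter.univ_mem)
    obtain ⟨g, hg⟩ := exists_smul_subset (G := G) isClosed_singleton
      (Set.singleton_ne_univ x) hU hU'
    exact ⟨g • x, hg (Set.smul_mem_smul_set rfl), mem_orbit x g⟩

variable (G) in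
theorem exists_smul_mem_ne {W : Set X} (hW : IsOpen W) {x : X} (hx : x ∈ W) :
    ∃ k : G, k • x ∈ W ∧ k • x ≠ x := by
  have hne : (W \ {x}).Nonempty :=
    ((infinite_of_mem_nhds x (hW.mem_nhds hx)).sdiff (Set.finite_singleton x)).nonempty
  exact (hW.sdiff isClosed_singleton).exists_smul_mem G x hne

theorem isLocallyMoving : IsLocallyMoving G X := by
  rintro U hU ⟨x, hx⟩
  obtain ⟨k, hkU, hkx⟩ := exists_smul_mem_ne G hU hx
  obtain ⟨v, hv, hvk⟩ := exists_germ_of_smul_ne hU hx hkU hkx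
  refine ⟨v, hv, fun h1 => hkx ?_⟩
  rw [← hvk.self_of_nhds, h1, one_smul]

theorem exists_germ [ContinuousConstSMul G X] {W : Set X} (hW : IsOpen W) {x : X} (hx : x ∈ W)
    {g : G} (hgx : g • x ∈ W) : ∃ v ∈ rigidStabilizer G W, ∀ᶠ y in 𝓝 x, v • y = g • y := by
  by_cases hne : g • x = x
  · obtain ⟨k, hkW, hkx⟩ := exists_smul_mem_ne G hW hx
    have hgk : (g * k⁻¹) • k • x = x := by rw [mul_smul, inv_smul_smul, hne]
    obtain ⟨v, hv, hvk⟩ := exists_germ_of_smul_ne hW hx hkW hkx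
    obtain ⟨v', hv', hvk'⟩ := exists_germ_of_smul_ne hW hkW (hgk.symm ▸ hx)
      (hgk.symm ▸ hkx.symm)
    refine ⟨v' * v, mul_mem hv' hv, ?_⟩
    filter_upwards [hvk, (continuous_const_smul k).continuousAt.eventually hvk'] with y hy hy'
    rw [mul_smul, hy, hy', mul_smul, inv_smul_smul]
  · exact exists_germ_of_smul_ne hW hx hgx hne

variable [FaithfulSMul G X] [ContinuousConstSMul G X]

theorem exists_mem_normal_smul_eq {N : Subgroup G} [N.Normal] (hN : N ≠ ⊥) (g : G) (x : X) :
    ∃ s ∈ N, s • x = g • x := by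
  have : Infinite X := Set.infinite_univ_iff.1 (infinite_of_mem_nhds x Filter.univ_mem)
  obtain ⟨p, hp⟩ := (Set.toFinite {x, g • x}).infinite_compl.nonempty
  obtain ⟨W, V, hW, hV, hxW, hpV, hWV⟩ := SeparatedNhds.of_isCompact_isCompact
    (Set.toFinite {x, g • x}).isCompact isCompact_singleton (Set.disjoint_singleton_right.2 hp)
  obtain ⟨hx, hgx⟩ := Set.pair_subset_iff.1 hxW
  obtain ⟨v, hv, hvg⟩ := exists_germ hW hx hgx
  obtain ⟨s, hs, hds⟩ := exists_mem_normal_disjoint_smul hN hV.isClosed_compl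
    fun h => Set.eq_univ_iff_forall.1 h p (hpV rfl)
  have hWs : Disjoint W (s • W) :=
    hds.mono hWV.subset_compl_right (Set.smul_set_mono hWV.subset_compl_right)
  exact ⟨⁅v, s⁆, commutatorElement_mem_of_right_mem v hs,
    (commutatorElement_smul_of_disjoint_smul hv hWs hx).trans hvg.self_of_nhds⟩

theorem isMinimal_of_normal {N : Subgroup G} [N.Normal] (hN : N ≠ ⊥) : IsMinimal N X where
  dense_orbit x := by
    refine (dense_orbit G x).mono ?_
    rintro _ ⟨g, rfl⟩
    obtain ⟨s, hs, hsg⟩ := exists_mem_normal_smul_eq hN g x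
    exact ⟨⟨s, hs⟩, hsg⟩

theorem exists_disjoint_smul_of_notMem {J : Set X} (hJ : IsClosed J) {x : X} (hx : x ∉ J) :
    ∃ s : G, (∀ᶠ y in 𝓝 x, s • y = y) ∧ Disjoint J (s • J) := by
  obtain ⟨k, hkJ, hkx⟩ := exists_smul_mem_ne G hJ.isOpen_compl hx
  have htop : (⊤ : Subgroup G) ≠ ⊥ := fun h => hkx <| by
    rw [Subgroup.mem_bot.1 (h ▸ Subgroup.mem_top k : k ∈ ⊥), one_smul]
  obtain ⟨u, -, hu⟩ := exists_mem_normal_disjoint_smul htop (isClosed_singleton.union hJ)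
    (Set.ne_univ_iff_exists_notMem _ |>.2 ⟨k • x, not_or.2 ⟨hkx, hkJ⟩⟩)
  have hu' : ∀ y ∈ {x} ∪ J, u • y ∈ Jᶜ := fun y hy hyJ =>
    Set.disjoint_left.1 hu (Or.inr hyJ) (Set.smul_mem_smul_set hy)
  obtain ⟨v, hv, hvu⟩ := exists_germ (g := u⁻¹) hJ.isOpen_compl (hu' x (Or.inl rfl))
    (by rwa [inv_smul_smul])
  refine ⟨v * u, ?_, Set.disjoint_right.2 ?_⟩
  · filter_upwards [(continuous_const_smul u).continuousAt.eventually hvu] with y hy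
    rw [mul_smul, hy, inv_smul_smul]
  · rintro _ ⟨y, hy, rfl⟩
    simp only [mul_smul]
    exact smul_mem_of_mem_rigidStabilizer hv (hu' y (Or.inr hy))

end IsFlexible

end Flexible

namespace Cantor

theorem prepend_injective (m : List Bool) : Function.Injective (prepend m) := by
  induction m with
  | nil => exact fun _ _ h => h
  | cons b m ih => exact fun _ _ h => ih (cons_inj h).2

theorem prepend_add_length (m : List Bool) (z : Cantor) (n : ℕ) :
    prepend m z (n + m.length) = z n := by
  induction m with
  | nil => rfl
  | cons _ _ ih => exact ih

theorem prepend_apply_of_lt (m : List Bool) (z z' : Cantor) {n : ℕ} (h : n < m.length) :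
    prepend m z n = prepend m z' n := by
  induction m generalizing n with
  | nil => exact absurd h (Nat.not_lt_zero n)
  | cons b m ih =>
    cases n with
    | zero => rfl
    | succ n => exact ih (Nat.lt_of_succ_lt_succ h)

theorem continuous_prepend (m : List Bool) : Continuous (prepend m) := by
  induction m with
  | nil => exact continuous_id
  | cons b m ih =>
    refine continuous_pi fun n => ?_
    cases n with
    | zero => exact continuous_const
    | succ n => exact (continuous_apply n).comp ih

theorem prepend_mem_sdi (m : List Bool) (z : Cantor) : prepend m z ∈ sdi m := ⟨z, rfl⟩

theorem sdi_append_subset (m u : List Bool) : sdi (m ++ u) ⊆ sdi m := by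
  rintro _ ⟨z, rfl⟩
  rw [prepend_append]
  exact prepend_mem_sdi _ _

theorem disjoint_sdi_append_cons (j m w : List Bool) {b c : Bool} (h : b ≠ c) :
    Disjoint (sdi (j ++ b :: m)) (sdi (j ++ c :: w)) := by
  refine Set.disjoint_left.2 ?_
  rintro _ ⟨y, rfl⟩ ⟨z, hz⟩
  rw [prepend_append, prepend_append] at hz
  exact h (cons_inj (prepend_injective j hz)).1.symm

theorem mem_sdi_singleton {b : Bool} {x : Cantor} : x ∈ sdi [b] ↔ x 0 = b := by
  constructor
  · rintro ⟨z, rfl⟩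
    rfl
  · rintro rfl
    exact ⟨fun n => x (n + 1), cons_head_tail x⟩

theorem compl_sdi_singleton (b : Bool) : (sdi [b])ᶜ = sdi [!b] := by
  ext x
  rw [Set.mem_compl_iff, mem_sdi_singleton, mem_sdi_singleton, Bool.eq_not]

theorem isClopen_sdi (m : List Bool) : IsClopen (sdi m) :=
  ⟨(isCompact_range (continuous_prepend m)).isClosed, isOpen_sdi m⟩

theorem exists_sdi_subset {U : Set Cantor} (hU : IsOpen U) {x : Cantor} (hx : x ∈ U) :
    ∃ m ≠ [], x ∈ sdi m ∧ sdi m ⊆ U := by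
  obtain ⟨_, ⟨y, n, rfl⟩, hxy, hyU⟩ :=
    (PiNat.isTopologicalBasis_cylinders (fun _ : ℕ => Bool)).exists_subset_of_mem_open hx hU
  obtain ⟨m, hm, z, rfl⟩ := exists_word (n + 1) x
  refine ⟨m, List.ne_nil_of_length_eq_add_one hm, ⟨z, rfl⟩, ?_⟩
  rintro _ ⟨z', rfl⟩
  refine hyU fun i hi => ?_
  rw [prepend_apply_of_lt m z' z (by lia)]
  exact hxy i hi

instance : PerfectSpace Cantor where
  univ_preperfect := by
    refine preperfect_iff_nhds.2 fun x _ U hU => ?_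
    obtain ⟨m, -, ⟨z, rfl⟩, hm⟩ :=
      exists_sdi_subset isOpen_interior (mem_interior_iff_mem_nhds.2 hU)
    refine ⟨prepend m fun n => !z n,
      ⟨interior_subset (hm (prepend_mem_sdi m _)), Set.mem_univ _⟩, fun h => ?_⟩
    exact Bool.not_ne_self _ (congrFun (prepend_injective m h) 0)

theorem continuous_of_adapted {f : Cantor → Cantor}
    (hf : ∀ x, ∃ m w, x ∈ sdi m ∧ Adapted f m w) : Continuous f := by
  refine continuous_iff_continuousAt.2 fun x => ?_
  obtain ⟨m, w, hx, h⟩ := hf x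
  have hc : Continuous fun y : Cantor => prepend w fun n => y (n + m.length) :=
    (continuous_prepend w).comp (continuous_pi fun n => continuous_apply _)
  refine hc.continuousAt.congr ?_
  filter_upwards [(isOpen_sdi m).mem_nhds hx]
  rintro _ ⟨z, rfl⟩
  rw [h z]
  exact congrArg (prepend w) (funext (prepend_add_length m z))

open Classical in
/-- The map of the Cantor space that exchanges the prefixes `a` and `b`, for words `a`, `b` whose
standard dyadic intervals are disjoint. -/
noncomputable def swap (a b : List Bool) (x : Cantor) : Cantor :=
  if h : x ∈ sdi a then prepend b h.choose
  else if h : x ∈ sdi b then prepend a h.choose else x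

section Swap

variable {a b : List Bool}

theorem adapted_swap_left : Adapted (swap a b) a b := fun z => by
  have h : prepend a z ∈ sdi a := prepend_mem_sdi a z
  rw [swap, dif_pos h, prepend_injective a h.choose_spec]

theorem adapted_swap_right (hab : Disjoint (sdi a) (sdi b)) : Adapted (swap a b) b a := fun z => by
  have h : prepend b z ∈ sdi b := prepend_mem_sdi b z
  rw [swap, dif_neg (Set.disjoint_right.1 hab h), dif_pos h, prepend_injective b h.choose_spec]

theorem swap_of_notMem {x : Cantor} (hx : x ∉ sdi a ∪ sdi b) : swap a b x = x := by
  rw [swap, dif_neg fun h => hx (Or.inl h), dif_neg fun h => hx (Or.inr h)]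

theorem involutive_swap (hab : Disjoint (sdi a) (sdi b)) : Function.Involutive (swap a b) := by
  intro x
  by_cases h : x ∈ sdi a ∪ sdi b
  · rcases h with ⟨z, rfl⟩ | ⟨z, rfl⟩
    · rw [adapted_swap_left z, adapted_swap_right hab z]
    · rw [adapted_swap_right hab z, adapted_swap_left z]
  · rw [swap_of_notMem h, swap_of_notMem h]

theorem exists_adapted_swap (hab : Disjoint (sdi a) (sdi b)) (x : Cantor) :
    ∃ m w, x ∈ sdi m ∧ Adapted (swap a b) m w := by
  by_cases h : x ∈ sdi a ∪ sdi b
  · rcases h with h | h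
    · exact ⟨a, b, h, adapted_swap_left⟩
    · exact ⟨b, a, h, adapted_swap_right hab⟩
  · obtain ⟨m, -, hx, hm⟩ :=
      exists_sdi_subset ((isClopen_sdi a).union (isClopen_sdi b)).compl.isOpen h
    exact ⟨m, m, hx, fun z => swap_of_notMem (hm (prepend_mem_sdi m z))⟩

end Swap

end Cantor

namespace ThompsonV

open Cantor
open scoped Pointwise

instance : MulAction ThompsonV Cantor where
  smul v x := v.1 x
  one_smul _ := rfl
  mul_smul _ _ _ := rfl

instance : FaithfulSMul ThompsonV Cantor := ⟨fun h => Subtype.ext (Homeomorph.ext h)⟩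

instance : ContinuousConstSMul ThompsonV Cantor := ⟨fun v => v.1.continuous⟩

theorem exists_adapted_subset (v : ThompsonV) {U : Set Cantor} (hU : IsOpen U) {x : Cantor}
    (hx : x ∈ U) : ∃ m w, x ∈ sdi m ∧ sdi m ⊆ U ∧ Adapted (v • ·) m w := by
  obtain ⟨⟨m, w⟩, ⟨z, rfl⟩, h⟩ := exists_adapted v x
  obtain ⟨u, -, ⟨y, rfl⟩, hu⟩ := exists_sdi_subset (hU.preimage (continuous_prepend m)) hx
  refine ⟨m ++ u, w ++ u, ⟨y, prepend_append m u y⟩, ?_, h.append u⟩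
  rintro _ ⟨y', rfl⟩
  rw [prepend_append]
  exact hu (prepend_mem_sdi u y')

theorem smul_sdi {v : ThompsonV} {a b : List Bool} (h : Adapted (v • ·) a b) :
    v • sdi a = sdi b := by
  rw [sdi, ← Set.image_smul, ← Set.range_comp]
  exact congrArg Set.range (funext h)

theorem exists_swap {a b : List Bool} (hab : Disjoint (sdi a) (sdi b)) :
    ∃ s ∈ rigidStabilizer ThompsonV (sdi a ∪ sdi b), Adapted (s • ·) a b ∧ Adapted (s • ·) b a := by
  have hc : Continuous (swap a b) := continuous_of_adapted (exists_adapted_swap hab)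
  let s : Cantor ≃ₜ Cantor := ⟨(involutive_swap hab).toPerm, hc, hc⟩
  exact ⟨⟨s, (isThompson_iff s).2 (exists_adapted_swap hab)⟩,
    mem_rigidStabilizer_iff.2 fun _ => swap_of_notMem, adapted_swap_left, adapted_swap_right hab⟩

theorem exists_adapted_of_ne_nil {a b : List Bool} (ha : a ≠ []) (hb : b ≠ []) :
    ∃ v : ThompsonV, Adapted (v • ·) a b := by
  obtain ⟨p, a, rfl⟩ := List.exists_cons_of_ne_nil ha
  obtain ⟨q, b, rfl⟩ := List.exists_cons_of_ne_nil hb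
  rcases ne_or_eq p q with h | rfl
  · obtain ⟨s, -, hs, -⟩ := exists_swap (disjoint_sdi_append_cons [] a b h)
    exact ⟨s, hs⟩
  · have hp : p ≠ !p := (Bool.not_ne_self p).symm
    obtain ⟨s, -, hs, -⟩ := exists_swap (disjoint_sdi_append_cons [] a [] hp)
    obtain ⟨t, -, -, ht⟩ := exists_swap (disjoint_sdi_append_cons [] b [] hp)
    exact ⟨t * s, fun z => (mul_smul t s _).trans ((congrArg (t • ·) (hs z)).trans (ht z))⟩

theorem sdi_subset_smulSupport {v : ThompsonV} {m w : List Bool} (h : Adapted (v • ·) m w)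
    (hne : m ≠ w) : sdi m ⊆ smulSupport Cantor v := by
  rintro _ ⟨z, rfl⟩
  refine mem_closure_iff.2 fun O hO hzO => ?_
  obtain ⟨u, -, -, hu⟩ := exists_sdi_subset (hO.preimage (continuous_prepend m)) hzO
  by_contra! hempty
  refine hne (List.append_cancel_right (bs := u) (word_ext fun y => ?_))
  have hfix : v • prepend m (prepend u y) = prepend m (prepend u y) := by
    by_contra hy
    exact Set.eq_empty_iff_forall_notMem.1 hempty _ ⟨hu (prepend_mem_sdi u y), hy⟩
  rw [prepend_append, ← hfix, prepend_append]
  exact h _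

instance : HasClopenSupports ThompsonV Cantor where
  isOpen_smulSupport v := by
    refine isOpen_iff_mem_nhds.2 fun x hx => ?_
    obtain ⟨m, w, hxm, -, hmw⟩ := exists_adapted_subset v isOpen_univ (Set.mem_univ x)
    refine Filter.mem_of_superset ((isOpen_sdi m).mem_nhds hxm) (sdi_subset_smulSupport hmw ?_)
    rintro rfl
    obtain ⟨_, ⟨y, rfl⟩, hy⟩ := mem_closure_iff.1 hx _ (isOpen_sdi m) hxm
    exact hy (hmw y)
  exists_smulSupport_subset {U} hU x hx := by
    obtain ⟨m, -, ⟨z, rfl⟩, hmU⟩ := exists_sdi_subset hU hx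
    have hd := disjoint_sdi_append_cons m [] [] (Bool.not_ne_self (z 0)).symm
    obtain ⟨s, hs, hs', -⟩ := exists_swap hd
    have hz : prepend m z ∈ sdi (m ++ [z 0]) :=
      ⟨fun n => z (n + 1), by rw [prepend_append]; exact congrArg _ (cons_head_tail z)⟩
    refine ⟨s, subset_closure fun hfix => ?_,
      (closure_minimal ?_ (isClopen_sdi m).isClosed).trans hmU⟩
    · refine Set.disjoint_left.1 hd hz ?_
      rw [← smul_sdi hs']
      exact ⟨_, hz, hfix⟩
    · exact fun y hy => Set.union_subset (sdi_append_subset _ _) (sdi_append_subset _ _)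
        (mem_of_smul_ne_of_mem_rigidStabilizer hs hy)

instance : IsFlexible ThompsonV Cantor where
  exists_smul_subset {F U} hF hF' hU := by
    rintro ⟨y, hy⟩
    obtain ⟨x, hx⟩ := (Set.ne_univ_iff_exists_notMem F).1 hF'
    obtain ⟨m, hm, -, hmF⟩ := exists_sdi_subset hF.isOpen_compl hx
    obtain ⟨w, hw, -, hwU⟩ := exists_sdi_subset hU hy
    obtain ⟨s, hs⟩ := exists_adapted_of_ne_nil hm (List.cons_ne_nil false [])
    obtain ⟨t, ht⟩ := exists_adapted_of_ne_nil (List.cons_ne_nil true []) hw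
    refine ⟨t * s, (Set.smul_set_mono (Set.subset_compl_comm.1 hmF)).trans ?_⟩
    rwa [mul_smul, Set.smul_set_compl, smul_sdi hs, compl_sdi_singleton, Bool.not_false,
      smul_sdi ht]
  exists_germ_of_smul_ne {W} hW x hx g hgx hne := by
    obtain ⟨U, hU, hxU, hUW, hd⟩ := exists_isOpen_disjoint_smul hW hx hne
    obtain ⟨m, w, hxm, hmU, hmw⟩ := exists_adapted_subset g
      (hU.inter (hW.preimage (continuous_const_smul g))) ⟨hxU, hgx⟩
    obtain ⟨hmU, hmW⟩ := Set.subset_inter_iff.1 hmU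
    have hwm : g • sdi m = sdi w := smul_sdi hmw
    obtain ⟨s, hs, hs', -⟩ := exists_swap (hwm ▸ hd.mono hmU (Set.smul_set_mono hmU))
    refine ⟨s, rigidStabilizer_mono (Set.union_subset (hmU.trans hUW) ?_) hs, ?_⟩
    · rw [← hwm, ← Set.image_smul]
      exact Set.image_subset_iff.2 hmW
    · filter_upwards [(isOpen_sdi m).mem_nhds hxm]
      rintro _ ⟨z, rfl⟩
      exact (hs' z).trans (hmw z).symm

end ThompsonV

section Loops

variable {X Γ : Type*} [TopologicalSpace X] [Group Γ] {U A B : Set X}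

/-- The subgroup of the locally constant maps that are trivial outside `A`. -/
def supportedLoops (Γ : Type*) {X : Type*} [TopologicalSpace X] [Group Γ] (A : Set X) :
    Subgroup (LocallyConstant X Γ) where
  carrier := {a | ∀ x ∉ A, a x = 1}
  one_mem' _ _ := rfl
  mul_mem' {a b} ha hb x hx := by rw [LocallyConstant.mul_apply, ha x hx, hb x hx, mul_one]
  inv_mem' {a} ha x hx := by rw [LocallyConstant.inv_apply, ha x hx, inv_one]

instance : (supportedLoops Γ A).Normal where
  conj_mem a ha b x hx := by
    rw [LocallyConstant.mul_apply, LocallyConstant.mul_apply, LocallyConstant.inv_apply, ha x hx,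
      mul_one, mul_inv_cancel]

theorem supportedLoops_mono (hAB : A ⊆ B) : supportedLoops Γ A ≤ supportedLoops Γ B :=
  fun _ ha x hx => ha x (Set.notMem_subset hAB hx)

theorem commute_of_mem_supportedLoops (hAB : Disjoint A B) {a b : LocallyConstant X Γ}
    (ha : a ∈ supportedLoops Γ A) (hb : b ∈ supportedLoops Γ B) : Commute a b := by
  refine LocallyConstant.ext fun x => ?_
  rw [LocallyConstant.mul_apply, LocallyConstant.mul_apply]
  by_cases hx : x ∈ A
  · rw [hb x (Set.disjoint_left.1 hAB hx), mul_one, one_mul]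
  · rw [ha x hx, mul_one, one_mul]

/-- The restriction of a locally constant map to a clopen set, extended by `1`, as a
homomorphism. -/
noncomputable def restrictLoop (Γ : Type*) {X : Type*} [TopologicalSpace X] [Group Γ] {U : Set X}
    (hU : IsClopen U) : LocallyConstant X Γ →* LocallyConstant X Γ :=
  MonoidHom.mk' (fun a => a.mulIndicator hU) fun a b => LocallyConstant.ext fun x =>
    congrFun (Set.mulIndicator_mul U a b) x

theorem restrictLoop_of_mem (hU : IsClopen U) (a : LocallyConstant X Γ) {x : X} (hx : x ∈ U) :
    restrictLoop Γ hU a x = a x :=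
  a.mulIndicator_of_mem hU hx

theorem restrictLoop_mem_supportedLoops (hU : IsClopen U) (a : LocallyConstant X Γ) :
    restrictLoop Γ hU a ∈ supportedLoops Γ U :=
  fun _ hx => a.mulIndicator_of_notMem hU hx

theorem restrictLoop_apply_eq_one (hU : IsClopen U) {a : LocallyConstant X Γ} {x : X}
    (hx : a x = 1) : restrictLoop Γ hU a x = 1 := by
  by_cases h : x ∈ U
  · rw [restrictLoop_of_mem hU a h, hx]
  · exact restrictLoop_mem_supportedLoops hU a x h

theorem restrictLoop_mul_restrictLoop_compl (hU : IsClopen U) (a : LocallyConstant X Γ) :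
    restrictLoop Γ hU a * restrictLoop Γ hU.compl a = a := by
  refine LocallyConstant.ext fun x => ?_
  rw [LocallyConstant.mul_apply]
  by_cases hx : x ∈ U
  · rw [restrictLoop_of_mem hU a hx,
      restrictLoop_mem_supportedLoops hU.compl a x (Set.notMem_compl_iff.2 hx), mul_one]
  · rw [restrictLoop_mem_supportedLoops hU a x hx, restrictLoop_of_mem hU.compl a hx, one_mul]

theorem map_mem_center_of_map_eq_map {Δ : Type*} [Group Δ] {f : LocallyConstant X Γ →* Δ}
    (hf : Function.Surjective f) (hU : IsClopen U) {a b : LocallyConstant X Γ}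
    (ha : a ∈ supportedLoops Γ U) (hb : b ∈ supportedLoops Γ Uᶜ) (hab : f a = f b) :
    f a ∈ Subgroup.center Δ := by
  refine Subgroup.mem_center_iff.2 fun d => ?_
  obtain ⟨e, rfl⟩ := hf d
  have hUe : Commute (f (restrictLoop Γ hU e)) (f a) := by
    rw [hab]
    exact (commute_of_mem_supportedLoops disjoint_compl_right
      (restrictLoop_mem_supportedLoops hU e) hb).map f
  have hUce : Commute (f (restrictLoop Γ hU.compl e)) (f a) :=
    (commute_of_mem_supportedLoops disjoint_compl_left
      (restrictLoop_mem_supportedLoops hU.compl e) ha).map f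
  rw [← restrictLoop_mul_restrictLoop_compl hU e, map_mul]
  exact hUe.mul_left hUce

theorem supportedLoops_le_ker_or_of_disjoint {H : Type*} [Group H] (Y : Type*) [MulAction H Y]
    [TopologicalSpace Y] [IsFlexible H Y] [T2Space Y] [PerfectSpace Y] [FaithfulSMul H Y]
    [ContinuousConstSMul H Y] {f : LocallyConstant X Γ →* H} [f.range.Normal] (hf : f ≠ 1)
    (hAB : Disjoint A B) : supportedLoops Γ A ≤ f.ker ∨ supportedLoops Γ B ≤ f.ker := by
  have hN : f.range ≠ ⊥ := mt MonoidHom.range_eq_bot_iff.1 hf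
  have : MulAction.IsMinimal f.range Y := IsFlexible.isMinimal_of_normal hN
  have : ContinuousConstSMul f.range Y := ⟨fun g => continuous_const_smul (g : H)⟩
  have hnormal (C : Set X) : ((supportedLoops Γ C).map f.rangeRestrict).Normal :=
    Subgroup.Normal.map inferInstance _ f.rangeRestrict_surjective
  have hmoving : IsLocallyMoving f.range Y :=
    (IsFlexible.isLocallyMoving (G := H)).subgroup_of_normal hN
  rw [← f.ker_rangeRestrict, ← Subgroup.map_eq_bot_iff, ← Subgroup.map_eq_bot_iff]
  refine hmoving.eq_bot_or_eq_bot_of_commute ?_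
  rintro _ ⟨a, ha, rfl⟩ _ ⟨b, hb, rfl⟩
  exact (commute_of_mem_supportedLoops hAB ha hb).map _

end Loops

section GermCocycle

open scoped Topology Pointwise

/-- A cocycle of an action of `G` on `X` with values in the automorphisms of `Γ` which is locally
constant and depends only on germs; it twists the action of `G` on the locally constant maps from
`X` to `Γ`. -/
structure GermCocycle (G X Γ : Type*) [Group G] [MulAction G X] [TopologicalSpace X]
    [Group Γ] where
  /-- The underlying map. -/
  toFun : G → X → MulAut Γ
  map_mul' (g h : G) (x : X) : toFun (g * h) x = toFun g (h • x) * toFun h x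
  map_eq_one' {g : G} {x : X} (h : ∀ᶠ y in 𝓝 x, g • y = y) : toFun g x = 1
  isLocallyConstant' (g : G) : IsLocallyConstant (toFun g)

namespace GermCocycle

variable {G X Γ : Type*} [Group G] [MulAction G X] [TopologicalSpace X] [Group Γ]

instance : CoeFun (GermCocycle G X Γ) fun _ => G → X → MulAut Γ := ⟨toFun⟩

variable (τ : GermCocycle G X Γ) {g h : G} {x : X}

theorem mul_apply (g h : G) (x : X) : τ (g * h) x = τ g (h • x) * τ h x := τ.map_mul' g h x

theorem eq_one_of_eventually (h : ∀ᶠ y in 𝓝 x, g • y = y) : τ g x = 1 := τ.map_eq_one' h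

theorem congr_of_eventually (hgh : ∀ᶠ y in 𝓝 x, g • y = h • y) : τ g x = τ h x := by
  have h1 : ∀ᶠ y in 𝓝 x, (h⁻¹ * g) • y = y := hgh.mono fun y hy => by
    rw [mul_smul, hy, inv_smul_smul]
  calc τ g x = τ (h * (h⁻¹ * g)) x := by rw [mul_inv_cancel_left]
    _ = τ h x := by rw [mul_apply, h1.self_of_nhds, τ.eq_one_of_eventually h1, mul_one]

variable [ContinuousConstSMul G X]

/-- The twisted action of a group element on locally constant maps. -/
def act (g : G) (a : LocallyConstant X Γ) : LocallyConstant X Γ where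
  toFun y := τ g (g⁻¹ • y) (a (g⁻¹ • y))
  isLocallyConstant :=
    (((τ.isLocallyConstant' g).prodMk a.isLocallyConstant).comp
      fun p : MulAut Γ × Γ => p.1 p.2).comp_continuous (continuous_const_smul g⁻¹)

theorem act_smul (g : G) (a : LocallyConstant X Γ) (x : X) : τ.act g a (g • x) = τ g x (a x) := by
  change τ g (g⁻¹ • g • x) (a (g⁻¹ • g • x)) = _
  rw [inv_smul_smul]

theorem act_mul (g : G) (a b : LocallyConstant X Γ) :
    τ.act g (a * b) = τ.act g a * τ.act g b :=
  LocallyConstant.ext fun y => map_mul (τ g (g⁻¹ • y)) _ _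

theorem act_mem_supportedLoops {A : Set X} {a : LocallyConstant X Γ} (ha : a ∈ supportedLoops Γ A)
    (g : G) : τ.act g a ∈ supportedLoops Γ (g • A) := fun x hx => by
  rw [← smul_inv_smul g x, act_smul, ha _ (mt Set.mem_smul_set_iff_inv_smul_mem.2 hx), map_one]

/-- One of the commuting images of the loops supported on two complementary clopen sets is trivial,
and then so is the other, because it can be moved into the first by some element of `G`. -/
theorem monoidHom_eq_one [TotallySeparatedSpace X] [Nontrivial X] [IsFlexible G X] {H : Type*}
    [Group H] (Y : Type*) [MulAction H Y] [TopologicalSpace Y] [IsFlexible H Y] [T2Space Y]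
    [PerfectSpace Y] [FaithfulSMul H Y] [ContinuousConstSMul H Y] (f : LocallyConstant X Γ →* H)
    [f.range.Normal] (hf : ∀ g a, f (τ.act g a) = 1 → f a = 1) : f = 1 := by
  by_contra hf1
  have hspread {U : Set X} (hU : IsClopen U) (hU' : U.Nonempty)
      (h : supportedLoops Γ U ≤ f.ker) : False := by
    obtain ⟨g, hg⟩ := IsFlexible.exists_smul_subset (G := G) hU.compl.isClosed
      (Set.compl_ne_univ.2 hU') hU.isOpen hU'
    refine hf1 (MonoidHom.ext fun a => ?_)
    rw [← restrictLoop_mul_restrictLoop_compl hU a, map_mul,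
      h (restrictLoop_mem_supportedLoops hU a),
      hf g _ (h (supportedLoops_mono hg
        (τ.act_mem_supportedLoops (restrictLoop_mem_supportedLoops hU.compl a) g))), mul_one,
      MonoidHom.one_apply]
  obtain ⟨x, y, hxy⟩ := exists_pair_ne X
  obtain ⟨U, hU, hx, hy⟩ := exists_isClopen_of_totally_separated hxy
  have hd : Disjoint U Uᶜ := disjoint_compl_right
  rcases supportedLoops_le_ker_or_of_disjoint Y hf1 hd with h | h
  · exact hspread hU ⟨x, hx⟩ h
  · exact hspread hU.compl ⟨y, hy⟩ h

end GermCocycle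

end GermCocycle

namespace GermCocycle

open scoped Topology

variable {G X Γ : Type*} [Group G] [MulAction G X] [TopologicalSpace X] [Group Γ]
  (σ : GermCocycle G X Γ)

/-- The group of the locally constant maps with central values that are invariant under the
twisted action. -/
def invariantCenter : Subgroup (LocallyConstant X Γ) where
  carrier := {z | (∀ x, z x ∈ Subgroup.center Γ) ∧ ∀ (g : G) (x : X), z (g • x) = σ g x (z x)}
  one_mem' := ⟨fun _ => Subgroup.one_mem _, fun g x => (map_one (σ g x)).symm⟩
  mul_mem' {a b} ha hb := ⟨fun x => Subgroup.mul_mem _ (ha.1 x) (hb.1 x), fun g x => by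
    rw [LocallyConstant.mul_apply, LocallyConstant.mul_apply, map_mul, ha.2, hb.2]⟩
  inv_mem' {a} ha := ⟨fun x => Subgroup.inv_mem _ (ha.1 x), fun g x => by
    rw [LocallyConstant.inv_apply, LocallyConstant.inv_apply, map_inv, ha.2]⟩

variable {σ} {z z' : LocallyConstant X Γ}

theorem commute_of_mem_invariantCenter (hz : z ∈ σ.invariantCenter) (a : LocallyConstant X Γ) :
    Commute z a :=
  LocallyConstant.ext fun x => (Subgroup.mem_center_iff.1 (hz.1 x) (a x)).symm

section ContinuousAction

variable [ContinuousConstSMul G X]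

theorem act_eq_self_iff {a : LocallyConstant X Γ} {g : G} :
    σ.act g a = a ↔ ∀ x, a (g • x) = σ g x (a x) := by
  refine ⟨fun h x => by rw [← act_smul, h], fun h => LocallyConstant.ext fun y => ?_⟩
  rw [← smul_inv_smul g y, act_smul, h]

theorem act_eq_self_of_mem_rigidStabilizer {a : LocallyConstant X Γ} {g : G}
    (hg : g ∈ rigidStabilizer G {x | a x = 1}) : σ.act g a = a := by
  refine act_eq_self_iff.2 fun x => ?_
  by_cases hx : a x = 1
  · have hgx : a (g • x) = 1 := smul_mem_of_mem_rigidStabilizer hg hx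
    rw [hx, hgx, map_one]
  · have hfix : ∀ᶠ y in 𝓝 x, g • y = y := Filter.mem_of_superset
      ((a.isLocallyConstant.isClosed_fiber 1).isOpen_compl.mem_nhds hx) fun _ hy =>
        smul_eq_of_mem_rigidStabilizer hg hy
    rw [hfix.self_of_nhds, σ.eq_one_of_eventually hfix, MulAut.one_apply]

variable [MulAction.IsMinimal G X]

theorem eq_one_of_forall_act_eq_self {a : LocallyConstant X Γ} (ha : ∀ g, σ.act g a = a) {x : X}
    (hx : a x = 1) : a = 1 := by
  refine LocallyConstant.ext fun y => ?_
  obtain ⟨g, hg : a (g • y) = 1⟩ :=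
    (a.isLocallyConstant.isOpen_fiber 1).exists_smul_mem G y ⟨x, hx⟩
  rwa [act_eq_self_iff.1 (ha g), map_eq_one_iff _ (σ g y).injective] at hg

theorem eq_of_mem_invariantCenter (hz : z ∈ σ.invariantCenter) (hz' : z' ∈ σ.invariantCenter)
    {x : X} (h : z x = z' x) : z = z' := by
  have hdiv := div_mem hz hz'
  refine div_eq_one.1 (eq_one_of_forall_act_eq_self (σ := σ) (x := x)
    (fun g => act_eq_self_iff.2 (hdiv.2 g)) ?_)
  rw [LocallyConstant.div_apply, h, div_self']

theorem exists_mem_invariantCenter_eqOn {W : Set X} (hW : IsOpen W) (hW' : W.Nonempty)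
    {b : LocallyConstant X Γ} (hbc : ∀ x ∈ W, b x ∈ Subgroup.center Γ)
    (hb : ∀ (g : G), ∀ x ∈ W, g • x ∈ W → b (g • x) = σ g x (b x)) :
    ∃ z ∈ σ.invariantCenter, Set.EqOn z b W := by
  have hwd {g h : G} {x y : X} (hx : x ∈ W) (hy : y ∈ W) (hxy : g • x = h • y) :
      σ g x (b x) = σ h y (b y) := by
    have hxy' : x = (g⁻¹ * h) • y := by rw [mul_smul, ← hxy, inv_smul_smul]
    rw [hxy', hb _ y hy (hxy' ▸ hx), ← MulAut.mul_apply, ← mul_apply, mul_inv_cancel_left]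
  choose u hu using fun x => hW.exists_smul_mem G x hW'
  let F (x : X) : Γ := σ (u x)⁻¹ (u x • x) (b (u x • x))
  have hF (g : G) {x : X} (hx : x ∈ W) : F (g • x) = σ g x (b x) :=
    hwd (hu _) hx (inv_smul_smul _ _)
  have hloc : IsLocallyConstant F := by
    refine (IsLocallyConstant.iff_eventually_eq _).2 fun x => ?_
    have hact {y : X} (hy : u x • y ∈ W) : F y = σ.act (u x)⁻¹ b y := by
      rw [← inv_smul_smul (u x) y, hF _ hy, act_smul]
    filter_upwards [(continuous_const_smul (u x)).continuousAt.preimage_mem_nhds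
      (hW.mem_nhds (hu x)), (IsLocallyConstant.iff_eventually_eq _).1
      (σ.act (u x)⁻¹ b).isLocallyConstant x] with y hyW hy
    rw [hact hyW, hact (hu x)]
    exact hy
  refine ⟨⟨F, hloc⟩, ⟨fun x => ?_, fun g x => ?_⟩, fun x hx => ?_⟩
  · exact MulEquivClass.apply_mem_center (σ (u x)⁻¹ (u x • x)) (hbc _ (hu x))
  · change F (g • x) = σ g x (F x)
    have hx : g • x = (g * (u x)⁻¹) • u x • x := by rw [mul_smul, inv_smul_smul]
    rw [hx, hF _ (hu x), mul_apply, inv_smul_smul, MulAut.mul_apply]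
  · change F x = b x
    rw [← one_smul G x, hF 1 hx, σ.eq_one_of_eventually (by simp), MulAut.one_apply, one_smul]

end ContinuousAction

end GermCocycle

/-- An isomorphism `κ` between groups of locally constant maps that intertwines two twisted
actions of `G` up to conjugation by a family `c`. -/
structure LoopIntertwiner {G X Γ Γ' : Type*} [Group G] [MulAction G X] [TopologicalSpace X]
    [ContinuousConstSMul G X] [Group Γ] [Group Γ'] (τ : GermCocycle G X Γ)
    (σ : GermCocycle G X Γ') where
  /-- The isomorphism. -/
  κ : LocallyConstant X Γ ≃* LocallyConstant X Γ'
  /-- The conjugating family. -/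
  c : G → LocallyConstant X Γ'
  map_act' (g : G) (a : LocallyConstant X Γ) : κ (τ.act g a) = c g * σ.act g (κ a) * (c g)⁻¹

theorem conj_apply_of_mem_center {Δ : Type*} [Group Δ] {h : Δ} (hh : h ∈ Subgroup.center Δ)
    (g : Δ) : MulAut.conj g h = h := by
  rw [MulAut.conj_apply, Subgroup.mem_center_iff.1 hh, mul_inv_cancel_right]

namespace LoopIntertwiner

variable {G X Γ Γ' : Type*} [Group G] [MulAction G X] [TopologicalSpace X]
  [ContinuousConstSMul G X] [Group Γ] [Group Γ'] {τ : GermCocycle G X Γ} {σ : GermCocycle G X Γ'}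
  (D : LoopIntertwiner τ σ)

theorem map_act_apply (g : G) (a : LocallyConstant X Γ) (x : X) :
    D.κ (τ.act g a) (g • x) = MulAut.conj (D.c g (g • x)) (σ g x (D.κ a x)) := by
  rw [D.map_act', LocallyConstant.mul_apply, LocallyConstant.mul_apply, LocallyConstant.inv_apply,
    GermCocycle.act_smul, MulAut.conj_apply]

variable [IsFlexible G X] [T2Space X] [PerfectSpace X] [FaithfulSMul G X]

/-- Both a conjugate of `a` and a translate of `a` disjoint from it are mapped by `κ` to loops with
a given conjugate of `κ a x` as their value at `x`. -/
theorem apply_mem_center {a : LocallyConstant X Γ} {x : X} (hax : a x = 1) :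
    D.κ a x ∈ Subgroup.center Γ' := by
  let U : Set X := {y | a y = 1}ᶜ
  have hU : IsClopen U := (a.isLocallyConstant.isClopen_fiber 1).compl
  have ha : a ∈ supportedLoops Γ U := fun _ hy => Set.notMem_compl_iff.1 hy
  obtain ⟨s, hs, hd⟩ := IsFlexible.exists_disjoint_smul_of_notMem (G := G) hU.isClosed
    (Set.notMem_compl_iff.2 hax : x ∉ U)
  let f : LocallyConstant X Γ →* Γ' := (LocallyConstant.evalMonoidHom x).comp D.κ.toMonoidHom
  have hf : Function.Surjective f := fun h =>
    ⟨D.κ.symm (LocallyConstant.const X h), by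
      change D.κ (D.κ.symm _) x = h
      rw [D.κ.apply_symm_apply]
      rfl⟩
  let b : LocallyConstant X Γ := D.κ.symm (D.c s)
  have hconj : f (b * a * b⁻¹) = MulAut.conj (D.c s x) (D.κ a x) := by
    change D.κ (b * a * b⁻¹) x = _
    rw [map_mul, map_mul, map_inv, D.κ.apply_symm_apply]
    rfl
  have hact : f (τ.act s a) = MulAut.conj (D.c s x) (D.κ a x) := by
    have h := D.map_act_apply s a x
    rwa [hs.self_of_nhds, σ.eq_one_of_eventually hs, MulAut.one_apply] at h
  have hmem := map_mem_center_of_map_eq_map hf hU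
    (Subgroup.Normal.conj_mem inferInstance a ha b)
    (supportedLoops_mono hd.subset_compl_left (τ.act_mem_supportedLoops ha s))
    (hconj.trans hact.symm)
  rw [hconj] at hmem
  exact (MulEquivClass.apply_mem_center_iff (MulAut.conj (D.c s x))).1 hmem

theorem map_act_apply_of_apply_eq_one {a : LocallyConstant X Γ} {x : X} (hax : a x = 1) (g : G) :
    D.κ (τ.act g a) (g • x) = σ g x (D.κ a x) := by
  rw [map_act_apply, conj_apply_of_mem_center
    (MulEquivClass.apply_mem_center (σ g x) (D.apply_mem_center hax))]

theorem apply_smul_of_apply_eq_one {a : LocallyConstant X Γ} {x : X} {g : G} (hx : a x = 1)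
    (hgx : a (g • x) = 1) : D.κ a (g • x) = σ g x (D.κ a x) := by
  obtain ⟨v, hv, hvg⟩ := IsFlexible.exists_germ (a.isLocallyConstant.isOpen_fiber 1) hx hgx
  rw [← hvg.self_of_nhds, ← σ.congr_of_eventually hvg, ← D.map_act_apply_of_apply_eq_one hx,
    GermCocycle.act_eq_self_of_mem_rigidStabilizer hv]

theorem exists_mem_invariantCenter_apply_eq (a : LocallyConstant X Γ) :
    ∃ z ∈ σ.invariantCenter, ∀ x, a x = 1 → z x = D.κ a x := by
  rcases Set.eq_empty_or_nonempty {x | a x = 1} with hW | hW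
  · exact ⟨1, Subgroup.one_mem _, fun x hx => (Set.eq_empty_iff_forall_notMem.1 hW x hx).elim⟩
  · exact GermCocycle.exists_mem_invariantCenter_eqOn (a.isLocallyConstant.isOpen_fiber 1) hW
      (fun x hx => D.apply_mem_center hx) fun g x hx hgx => D.apply_smul_of_apply_eq_one hx hgx

/-- A central part of an intertwiner `κ`: a homomorphism to the invariant central loops which
agrees with `κ a` wherever `a` is trivial. -/
structure CentralPart (D : LoopIntertwiner τ σ) where
  /-- The homomorphism. -/
  ζ : LocallyConstant X Γ →* LocallyConstant X Γ'
  mem_invariantCenter (a : LocallyConstant X Γ) : ζ a ∈ σ.invariantCenter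
  apply_eq {a : LocallyConstant X Γ} {x : X} (hx : a x = 1) : ζ a x = D.κ a x

omit [T2Space X] in
/-- By its uniqueness, the invariant extension of `κ a` is multiplicative on the loops `a` that are
trivial at a given point, and every loop is a product of two such loops. -/
theorem nonempty_centralPart [TotallySeparatedSpace X] [Nontrivial X] : Nonempty D.CentralPart := by
  choose z hz hza using D.exists_mem_invariantCenter_apply_eq
  have hmul {x : X} {a b : LocallyConstant X Γ} (ha : a x = 1) (hb : b x = 1) :
      z (a * b) = z a * z b := by
    refine GermCocycle.eq_of_mem_invariantCenter (hz _) (mul_mem (hz _) (hz _)) (x := x) ?_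
    rw [LocallyConstant.mul_apply, hza a x ha, hza b x hb, ← LocallyConstant.mul_apply, ← map_mul]
    exact hza _ x (by rw [LocallyConstant.mul_apply, ha, hb, one_mul])
  obtain ⟨x, y, hxy⟩ := exists_pair_ne X
  obtain ⟨U, hU, hx, hy⟩ := exists_isClopen_of_totally_separated hxy
  refine ⟨⟨MonoidHom.mk' (fun a => z (restrictLoop Γ hU a) * z (restrictLoop Γ hU.compl a))
    fun a b => ?_, fun a => mul_mem (hz _) (hz _), fun {a p} hp => ?_⟩⟩
  · have hUy (e : LocallyConstant X Γ) : restrictLoop Γ hU e y = 1 :=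
      restrictLoop_mem_supportedLoops hU e y hy
    have hUcx (e : LocallyConstant X Γ) : restrictLoop Γ hU.compl e x = 1 :=
      restrictLoop_mem_supportedLoops hU.compl e x (Set.notMem_compl_iff.2 hx)
    rw [map_mul, map_mul, hmul (hUy a) (hUy b), hmul (hUcx a) (hUcx b)]
    exact (GermCocycle.commute_of_mem_invariantCenter (hz _) _).mul_mul_mul_comm _ _
  · change (z (restrictLoop Γ hU a) * z (restrictLoop Γ hU.compl a)) p = _
    rw [LocallyConstant.mul_apply, hza _ p (restrictLoop_apply_eq_one hU hp),
      hza _ p (restrictLoop_apply_eq_one hU.compl hp), ← LocallyConstant.mul_apply, ← map_mul,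
      restrictLoop_mul_restrictLoop_compl]

end LoopIntertwiner

namespace LoopIntertwiner.CentralPart

variable {G X Γ Γ' : Type*} [Group G] [MulAction G X] [TopologicalSpace X]
  [ContinuousConstSMul G X] [Group Γ] [Group Γ'] {τ : GermCocycle G X Γ} {σ : GermCocycle G X Γ'}
  {D : LoopIntertwiner τ σ} (Z : D.CentralPart)

/-- The quotient of an intertwiner by its central part. -/
def spatialHom : LocallyConstant X Γ →* LocallyConstant X Γ' :=
  MonoidHom.mk' (fun a => (Z.ζ a)⁻¹ * D.κ a) fun a b => by
    have hcomm (e : LocallyConstant X Γ') : Commute (Z.ζ b)⁻¹ e :=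
      GermCocycle.commute_of_mem_invariantCenter (inv_mem (Z.mem_invariantCenter b)) e
    rw [map_mul, map_mul, mul_inv_rev, (hcomm _).eq, (hcomm _).mul_mul_mul_comm]

theorem ζ_mul_spatialHom (a : LocallyConstant X Γ) : Z.ζ a * Z.spatialHom a = D.κ a :=
  mul_inv_cancel_left _ _

theorem spatialHom_congr {a b : LocallyConstant X Γ} {x : X} (hab : a x = b x) :
    Z.spatialHom a x = Z.spatialHom b x := by
  have hdiv : (a / b) x = 1 := by rw [LocallyConstant.div_apply, hab, div_self']
  have h : Z.spatialHom (a / b) x = 1 := by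
    change (Z.ζ (a / b) x)⁻¹ * D.κ (a / b) x = 1
    rw [Z.apply_eq hdiv, inv_mul_cancel]
  rwa [map_div, LocallyConstant.div_apply, div_eq_one] at h

/-- The action of the spatial part of an intertwiner on the values at a point. -/
def fiberHom (x : X) : Γ →* Γ' :=
  (LocallyConstant.evalMonoidHom x).comp (Z.spatialHom.comp LocallyConstant.constMonoidHom)

theorem spatialHom_apply (a : LocallyConstant X Γ) (x : X) :
    Z.spatialHom a x = Z.fiberHom x (a x) :=
  Z.spatialHom_congr rfl

theorem eq_one_of_spatialHom_eq_one [MulAction.IsMinimal G X] {a : LocallyConstant X Γ} {x : X}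
    (hx : a x = 1) (ha : Z.spatialHom a = 1) : a = 1 := by
  have hκ : D.κ a ∈ σ.invariantCenter := by
    rw [← Z.ζ_mul_spatialHom, ha, mul_one]
    exact Z.mem_invariantCenter a
  refine GermCocycle.eq_one_of_forall_act_eq_self (σ := τ) (fun g => D.κ.injective ?_) hx
  rw [D.map_act', GermCocycle.act_eq_self_iff.2 (hκ.2 g),
    ← (GermCocycle.commute_of_mem_invariantCenter hκ _).eq, mul_inv_cancel_right]

variable [IsFlexible G X] [TotallySeparatedSpace X] [PerfectSpace X] [Nontrivial X]

theorem fiberHom_injective (x : X) : Function.Injective (Z.fiberHom x) := by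
  refine (injective_iff_map_eq_one _).2 fun γ hγ => ?_
  let a : LocallyConstant X Γ := LocallyConstant.const X γ
  obtain ⟨y, hxy⟩ := exists_ne x
  obtain ⟨U, hU, hxU, hy⟩ := exists_isClopen_of_totally_separated hxy.symm
  have hV : IsClopen ({p | Z.spatialHom a p = 1} ∩ U) :=
    ((Z.spatialHom a).isLocallyConstant.isClopen_fiber 1).inter hU
  have h1 : restrictLoop Γ hV a = 1 := by
    refine Z.eq_one_of_spatialHom_eq_one
      (restrictLoop_mem_supportedLoops hV a y fun h => hy h.2) (LocallyConstant.ext fun p => ?_)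
    by_cases hp : p ∈ {p | Z.spatialHom a p = 1} ∩ U
    · rw [Z.spatialHom_congr (restrictLoop_of_mem hV a hp)]
      exact hp.1
    · rw [Z.spatialHom_apply, restrictLoop_mem_supportedLoops hV a p hp, map_one]
      rfl
  have hx : restrictLoop Γ hV a x = γ := restrictLoop_of_mem hV a ⟨hγ, hxU⟩
  rw [← hx, h1, LocallyConstant.one_apply]

variable [FaithfulSMul G X]

theorem ζ_act (g : G) (a : LocallyConstant X Γ) : Z.ζ (τ.act g a) = Z.ζ a := by
  have htriv {e : LocallyConstant X Γ} {x : X} (hx : e x = 1) : Z.ζ (τ.act g e) = Z.ζ e := by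
    refine GermCocycle.eq_of_mem_invariantCenter (Z.mem_invariantCenter _)
      (Z.mem_invariantCenter _) (x := g • x) ?_
    rw [Z.apply_eq (by rw [GermCocycle.act_smul, hx, map_one]),
      D.map_act_apply_of_apply_eq_one hx, (Z.mem_invariantCenter e).2, Z.apply_eq hx]
  obtain ⟨x, y, hxy⟩ := exists_pair_ne X
  obtain ⟨U, hU, hx, hy⟩ := exists_isClopen_of_totally_separated hxy
  rw [← restrictLoop_mul_restrictLoop_compl hU a, GermCocycle.act_mul, map_mul, map_mul,
    htriv (restrictLoop_mem_supportedLoops hU a y hy),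
    htriv (restrictLoop_mem_supportedLoops hU.compl a x (Set.notMem_compl_iff.2 hx))]

theorem fiberHom_smul (g : G) (x : X) (γ : Γ) :
    Z.fiberHom (g • x) (τ g x γ) = MulAut.conj (D.c g (g • x)) (σ g x (Z.fiberHom x γ)) := by
  let a : LocallyConstant X Γ := LocallyConstant.const X γ
  have hζ : MulAut.conj (D.c g (g • x)) (σ g x (Z.ζ a x)) = Z.ζ a (g • x) := by
    rw [← (Z.mem_invariantCenter a).2, conj_apply_of_mem_center ((Z.mem_invariantCenter a).1 _)]
  have h := D.map_act_apply g a x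
  rw [← Z.ζ_mul_spatialHom, ← Z.ζ_mul_spatialHom, Z.ζ_act, LocallyConstant.mul_apply,
    LocallyConstant.mul_apply, map_mul, map_mul, hζ, Z.spatialHom_apply, Z.spatialHom_apply,
    GermCocycle.act_smul] at h
  exact mul_left_cancel h

theorem apply_mem_range_fiberHom_of_apply_smul_mem {z : LocallyConstant X Γ'}
    (hz : z ∈ σ.invariantCenter) {g : G} {x : X} (h : z (g • x) ∈ (Z.fiberHom (g • x)).range) :
    z x ∈ (Z.fiberHom x).range := by
  obtain ⟨γ, hγ⟩ := h
  refine ⟨(τ g x)⁻¹ γ, (σ g x).injective ((MulAut.conj (D.c g (g • x))).injective ?_)⟩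
  rw [← Z.fiberHom_smul, MulAut.apply_inv_self, hγ, ← hz.2, conj_apply_of_mem_center (hz.1 _)]

theorem fiberHom_surjective (x : X) : Function.Surjective (Z.fiberHom x) := by
  intro h
  obtain ⟨y, hxy⟩ := exists_ne x
  obtain ⟨U, hU, hx, hy⟩ := exists_isClopen_of_totally_separated hxy.symm
  let b : LocallyConstant X Γ' := restrictLoop Γ' hU (LocallyConstant.const X h)
  let a : LocallyConstant X Γ := D.κ.symm b
  have hab (p : X) : Z.ζ a p * Z.fiberHom p (a p) = b p := by
    rw [← Z.spatialHom_apply, ← LocallyConstant.mul_apply, Z.ζ_mul_spatialHom,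
      D.κ.apply_symm_apply]
  obtain ⟨g, hg⟩ := hU.compl.isOpen.exists_smul_mem G x ⟨y, hy⟩
  have hζ : Z.ζ a x ∈ (Z.fiberHom x).range := by
    refine Z.apply_mem_range_fiberHom_of_apply_smul_mem (Z.mem_invariantCenter a) (g := g)
      ⟨(a (g • x))⁻¹, ?_⟩
    rw [map_inv, eq_comm, eq_inv_iff_mul_eq_one, hab]
    exact restrictLoop_mem_supportedLoops hU _ _ hg
  have hbx : b x = h := restrictLoop_of_mem hU _ hx
  rw [← hbx, ← hab x]
  exact mul_mem hζ ⟨a x, rfl⟩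

/-- The isomorphism of the fibres at a point given by the spatial part of an intertwiner. -/
noncomputable def fiberEquiv (x : X) : Γ ≃* Γ' :=
  MulEquiv.ofBijective (Z.fiberHom x) ⟨Z.fiberHom_injective x, Z.fiberHom_surjective x⟩

theorem spatialHom_bijective : Function.Bijective Z.spatialHom := by
  refine ⟨(injective_iff_map_eq_one _).2 fun a ha => LocallyConstant.ext fun x => ?_, fun b => ?_⟩
  · refine (map_eq_one_iff _ (Z.fiberHom_injective x)).1 ?_
    rw [← Z.spatialHom_apply, ha, LocallyConstant.one_apply]
  · let t (x : X) : Γ := (Z.fiberEquiv x).symm (b x)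
    have ht : IsLocallyConstant t := by
      refine (IsLocallyConstant.iff_eventually_eq _).2 fun x => ?_
      let a : LocallyConstant X Γ := LocallyConstant.const X (t x)
      have hax : Z.spatialHom a x = b x := (Z.fiberEquiv x).apply_symm_apply (b x)
      filter_upwards [(IsLocallyConstant.iff_eventually_eq _).1 b.isLocallyConstant x,
        (IsLocallyConstant.iff_eventually_eq _).1 (Z.spatialHom a).isLocallyConstant x] with y hb ha
      exact (Z.fiberEquiv y).symm_apply_eq.2 (hb.trans (hax.symm.trans ha.symm))
    refine ⟨⟨t, ht⟩, LocallyConstant.ext fun x => ?_⟩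
    rw [Z.spatialHom_apply]
    exact (Z.fiberEquiv x).apply_symm_apply (b x)

/-- The spatial part of an intertwiner, as an isomorphism. -/
noncomputable def spatialEquiv : LocallyConstant X Γ ≃* LocallyConstant X Γ' :=
  MulEquiv.ofBijective Z.spatialHom Z.spatialHom_bijective

end LoopIntertwiner.CentralPart

section Comap

variable {G H X Y Γ Γ' : Type*} [Group G] [Group H] [MulAction G X] [MulAction H Y]
  [TopologicalSpace X] [TopologicalSpace Y] [Group Γ] [Group Γ']

/-- The isomorphism of groups of locally constant maps given by a homeomorphism of the spaces. -/
def loopCongr (Γ : Type*) [Group Γ] (φ : X ≃ₜ Y) : LocallyConstant X Γ ≃* LocallyConstant Y Γ where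
  __ := LocallyConstant.congrLeft φ
  map_mul' _ _ := rfl

theorem loopCongr_apply (φ : X ≃ₜ Y) (a : LocallyConstant X Γ) (x : X) :
    loopCongr Γ φ a (φ x) = a x :=
  congrArg a (φ.symm_apply_apply x)

namespace GermCocycle

/-- The pullback of a cocycle along an equivariant pair of a homomorphism of groups and a
homeomorphism of spaces. -/
def comap (σ : GermCocycle H Y Γ) (ψ : G →* H) (φ : X ≃ₜ Y)
    (hφ : ∀ (g : G) (x : X), φ (g • x) = ψ g • φ x) : GermCocycle G X Γ where
  toFun g x := σ (ψ g) (φ x)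
  map_mul' g h x := by rw [map_mul, mul_apply, hφ]
  map_eq_one' {g x} h := σ.eq_one_of_eventually <| by
    rw [← φ.map_nhds_eq, Filter.eventually_map]
    filter_upwards [h] with y hy
    rw [← hφ, hy]
  isLocallyConstant' g := (σ.isLocallyConstant' (ψ g)).comp_continuous φ.continuous

variable {σ : GermCocycle H Y Γ}

theorem loopCongr_mem_invariantCenter {ψ : G →* H} {φ : X ≃ₜ Y}
    {hφ : ∀ (g : G) (x : X), φ (g • x) = ψ g • φ x} (hψ : Function.Surjective ψ)
    {z : LocallyConstant X Γ} (hz : z ∈ (σ.comap ψ φ hφ).invariantCenter) :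
    loopCongr Γ φ z ∈ σ.invariantCenter := by
  refine ⟨fun y => hz.1 _, fun h y => ?_⟩
  obtain ⟨g, rfl⟩ := hψ h
  obtain ⟨x, rfl⟩ := φ.surjective y
  rw [← hφ, loopCongr_apply, loopCongr_apply]
  exact hz.2 g x

theorem loopCongr_symm_act [ContinuousConstSMul G X] [ContinuousConstSMul H Y] {ψ : G →* H}
    {φ : X ≃ₜ Y} (hφ : ∀ (g : G) (x : X), φ (g • x) = ψ g • φ x) (g : G)
    (a : LocallyConstant Y Γ) :
    (loopCongr Γ φ).symm (σ.act (ψ g) a) =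
      (σ.comap ψ φ hφ).act g ((loopCongr Γ φ).symm a) := by
  refine LocallyConstant.ext fun x => ?_
  rw [← smul_inv_smul g x, act_smul]
  change σ.act (ψ g) a (φ _) = _
  rw [hφ, act_smul]
  rfl

end GermCocycle

variable [ContinuousConstSMul G X] [ContinuousConstSMul H Y] [IsFlexible G X]
  [TotallySeparatedSpace X] [PerfectSpace X] [Nontrivial X] [FaithfulSMul G X]

theorem exists_spatial_decomposition {τ : GermCocycle G X Γ} {σ : GermCocycle H Y Γ'} (ψ : G ≃* H)
    (φ : X ≃ₜ Y) (hφ : ∀ (g : G) (x : X), φ (g • x) = ψ g • φ x)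
    (κ : LocallyConstant X Γ ≃* LocallyConstant Y Γ') (c : G → LocallyConstant Y Γ')
    (hκ : ∀ g a, κ (τ.act g a) = c g * σ.act (ψ g) (κ a) * (c g)⁻¹) :
    ∃ (ζ : LocallyConstant X Γ →* LocallyConstant Y Γ')
      (κ' : LocallyConstant X Γ ≃* LocallyConstant Y Γ') (κₓ : X → Γ ≃* Γ'),
      (∀ a, ζ a ∈ σ.invariantCenter) ∧ (∀ g a, ζ (τ.act g a) = ζ a) ∧ (∀ a, κ a = ζ a * κ' a) ∧
      (∀ a x, κ' a (φ x) = κₓ x (a x)) ∧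
      ∀ g x γ, κₓ (g • x) (τ g x γ) =
        MulAut.conj (c g (φ (g • x))) (σ (ψ g) (φ x) (κₓ x γ)) := by
  let e : LocallyConstant X Γ' ≃* LocallyConstant Y Γ' := loopCongr Γ' φ
  let D : LoopIntertwiner τ (σ.comap ψ φ hφ) :=
    { κ := κ.trans e.symm
      c := fun g => e.symm (c g)
      map_act' := fun g a => by
        rw [MulEquiv.trans_apply, hκ, map_mul, map_mul, map_inv,
          ← MulEquiv.coe_toMonoidHom ψ, GermCocycle.loopCongr_symm_act hφ]
        rfl }
  obtain ⟨Z⟩ := D.nonempty_centralPart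
  refine ⟨e.toMonoidHom.comp Z.ζ, Z.spatialEquiv.trans e, Z.fiberEquiv, fun a => ?_, fun g a => ?_,
    fun a => ?_, fun a x => ?_, Z.fiberHom_smul⟩
  · exact GermCocycle.loopCongr_mem_invariantCenter ψ.surjective (Z.mem_invariantCenter a)
  · exact congrArg e (Z.ζ_act g a)
  · have h : e.symm (κ a) = Z.ζ a * Z.spatialHom a := (Z.ζ_mul_spatialHom a).symm
    exact (e.symm_apply_eq.1 h).trans (map_mul e _ _)
  · exact (loopCongr_apply φ _ x).trans (Z.spatialHom_apply a x)

end Comap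

section SplitExtension

open SemidirectProduct

variable {N N' G G' : Type*} [Group N] [Group N'] [Group G] [Group G'] {φ : G →* MulAut N}
  {φ' : G' →* MulAut N'}

/-- An isomorphism of semidirect products preserves the kernel if it maps the left factor onto the
left factor, which is the kernel of the projection to the right factor. -/
structure PreservesKernel (θ : N ⋊[φ] G ≃* N' ⋊[φ'] G') : Prop where
  right_map_inl (n : N) : (θ (inl n)).right = 1
  right_symm_map_inl (n : N') : (θ.symm (inl n)).right = 1

namespace PreservesKernel

variable {θ : N ⋊[φ] G ≃* N' ⋊[φ'] G'}

theorem symm (h : PreservesKernel θ) : PreservesKernel θ.symm :=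
  ⟨h.right_symm_map_inl, h.right_map_inl⟩

theorem inl_left_map_inl (h : PreservesKernel θ) (n : N) : inl (θ (inl n)).left = θ (inl n) :=
  SemidirectProduct.ext (left_inl _) ((right_inl _).trans (h.right_map_inl n).symm)

theorem right_symm_map_inr (h : PreservesKernel θ) (g : G) :
    (θ.symm (inr (θ (inr g)).right)).right = g := by
  have hg := congrArg (fun k => (θ.symm k).right) (inl_left_mul_inr_right (θ (inr g)))
  simpa only [map_mul, mul_right, h.right_symm_map_inl, one_mul, θ.symm_apply_apply, right_inr]
    using hg

/-- The isomorphism of the left factors induced by a kernel-preserving isomorphism. -/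
def kernelEquiv (h : PreservesKernel θ) : N ≃* N' where
  toFun n := (θ (inl n)).left
  invFun n := (θ.symm (inl n)).left
  left_inv n := by beta_reduce; rw [h.inl_left_map_inl, θ.symm_apply_apply, left_inl]
  right_inv n := by beta_reduce; rw [h.symm.inl_left_map_inl, θ.apply_symm_apply, left_inl]
  map_mul' m n := by rw [map_mul, map_mul, mul_left, h.right_map_inl, map_one, MulAut.one_apply]

/-- The isomorphism of the right factors induced by a kernel-preserving isomorphism. -/
def quotientEquiv (h : PreservesKernel θ) : G ≃* G' where
  toFun g := (θ (inr g)).right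
  invFun g := (θ.symm (inr g)).right
  left_inv := h.right_symm_map_inr
  right_inv := h.symm.right_symm_map_inr
  map_mul' g k := by rw [map_mul, map_mul, mul_right]

theorem map_inl (h : PreservesKernel θ) (n : N) : θ (inl n) = inl (h.kernelEquiv n) :=
  (h.inl_left_map_inl n).symm

theorem map_inr (h : PreservesKernel θ) (g : G) :
    θ (inr g) = inl (θ (inr g)).left * inr (h.quotientEquiv g) :=
  (inl_left_mul_inr_right _).symm

theorem left_map_inr_mul (h : PreservesKernel θ) (g k : G) :
    (θ (inr (g * k))).left =
      (θ (inr g)).left * φ' (h.quotientEquiv g) (θ (inr k)).left := by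
  rw [map_mul, map_mul, mul_left]
  rfl

theorem kernelEquiv_smul (h : PreservesKernel θ) (g : G) (n : N) :
    h.kernelEquiv (φ g n) =
      (θ (inr g)).left * φ' (h.quotientEquiv g) (h.kernelEquiv n) * (θ (inr g)).left⁻¹ := by
  apply inl_injective (φ := φ')
  rw [← h.map_inl, inl_aut, map_mul, map_mul, map_inv, map_inv, map_mul, map_mul, map_inv, inl_aut,
    h.map_inl]
  generalize hc : (θ (inr g)).left = c
  rw [h.map_inr g, hc, map_inv]
  group

end PreservesKernel

end SplitExtension

section FractionGroup

open SemidirectProduct Cantor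

variable {Γ Γ' : Type*} [Group Γ] [Group Γ'] {α₀ α₁ : MulAut Γ} {β₀ β₁ : MulAut Γ'}

variable (α₀ α₁) in
/-- The map `τ` as a cocycle of the action of `V` on the Cantor space. -/
noncomputable def tauCocycle : GermCocycle ThompsonV Cantor Γ where
  toFun := tau α₀ α₁
  map_mul' := tau_mul α₀ α₁
  map_eq_one' {v x} h := by
    obtain ⟨m, -, hx, hm⟩ := exists_sdi_subset isOpen_interior (mem_interior_iff_mem_nhds.2 h)
    have hfix : Adapted v.1 m m := fun z =>
      interior_subset (s := {y | v • y = y}) (hm (prepend_mem_sdi m z))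
    rw [tau_eq α₀ α₁ v hx hfix, inv_mul_cancel]
  isLocallyConstant' := isLocallyConstant_tau α₀ α₁

theorem tauCocycle_act (v : ThompsonV) (a : LoopGroup Γ) :
    (tauCocycle α₀ α₁).act v a = jonesAction α₀ α₁ v a :=
  rfl

theorem inl_mem_center_of_mem_invariantCenter {z : LoopGroup Γ}
    (hz : z ∈ (tauCocycle α₀ α₁).invariantCenter) :
    inl z ∈ Subgroup.center (FractionGroup α₀ α₁) := by
  refine Subgroup.mem_center_iff.2 fun g => ?_
  have hg : jonesAction α₀ α₁ g.right z = z := GermCocycle.act_eq_self_iff.2 (hz.2 g.right)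
  have hcomm : z * g.left = g.left * z := GermCocycle.commute_of_mem_invariantCenter hz g.left
  ext1
  · rw [mul_left, mul_left, left_inl, right_inl, map_one, MulAut.one_apply, hg, hcomm]
  · rw [mul_right, mul_right, right_inl, mul_one, one_mul]

theorem FractionGroup.right_map_inl (θ : FractionGroup α₀ α₁ ≃* FractionGroup β₀ β₁)
    (a : LoopGroup Γ) : (θ (inl a)).right = 1 := by
  let f : LoopGroup Γ →* ThompsonV := (rightHom.comp θ.toMonoidHom).comp inl
  have hrange : f.range.Normal := by
    rw [MonoidHom.range_comp, range_inl_eq_ker_rightHom]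
    exact Subgroup.Normal.map inferInstance _ (rightHom_surjective.comp θ.surjective)
  have hf : ∀ v a, f ((tauCocycle α₀ α₁).act v a) = 1 → f a = 1 := fun v a h => by
    rw [tauCocycle_act, MonoidHom.comp_apply, inl_aut, map_mul, map_mul, map_inv, map_inv] at h
    exact conj_eq_one_iff.1 h
  exact DFunLike.congr_fun ((tauCocycle α₀ α₁).monoidHom_eq_one Cantor f hf) a

theorem FractionGroup.preservesKernel (θ : FractionGroup α₀ α₁ ≃* FractionGroup β₀ β₁) :
    PreservesKernel θ :=
  ⟨right_map_inl θ, right_map_inl θ.symm⟩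

/-- The extension to the fraction group, trivial on `V`, of a `V`-invariant homomorphism with
values in the invariant centre. -/
noncomputable def centralHom (ζ : LoopGroup Γ →* LoopGroup Γ')
    (hζ : ∀ a, ζ a ∈ (tauCocycle β₀ β₁).invariantCenter)
    (hζv : ∀ v a, ζ ((tauCocycle α₀ α₁).act v a) = ζ a) :
    FractionGroup α₀ α₁ →* Subgroup.center (FractionGroup β₀ β₁) :=
  MonoidHom.mk' (fun g => ⟨inl (ζ g.left), inl_mem_center_of_mem_invariantCenter (hζ _)⟩)
    fun g h => Subtype.ext <| by
      change inl (ζ (g * h).left) = inl (ζ g.left) * inl (ζ h.left)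
      rw [mul_left, map_mul, ← tauCocycle_act, hζv, map_mul]

end FractionGroup

section Normalizer

variable {ψ : ThompsonV ≃* ThompsonV}

theorem mem_normalizer_of_map_smul {φ : Cantor ≃ₜ Cantor}
    (h : ∀ (v : ThompsonV) (x : Cantor), φ (v • x) = ψ v • φ x) :
    φ ∈ Subgroup.normalizer (ThompsonV : Set (Cantor ≃ₜ Cantor)) := by
  have hconj (v : ThompsonV) : φ * v.1 * φ⁻¹ = (ψ v).1 :=
    mul_inv_eq_of_eq_mul (Homeomorph.ext (h v))
  refine fun g => ⟨fun hg => ?_, fun hg => ?_⟩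
  · exact hconj ⟨g, hg⟩ ▸ (ψ _).2
  · obtain ⟨v, hv⟩ := ψ.surjective ⟨_, hg⟩
    have hvg : v.1 = g := mul_left_cancel (mul_right_cancel ((hconj v).trans (congrArg _ hv)))
    exact hvg ▸ v.2

theorem ad_eq_of_map_smul {φ : Subgroup.normalizer (ThompsonV : Set (Cantor ≃ₜ Cantor))}
    (h : ∀ (v : ThompsonV) (x : Cantor), φ.1 (v • x) = ψ v • φ.1 x) (v : ThompsonV) :
    ThompsonV.ad φ v = ψ v :=
  Subtype.ext (mul_inv_eq_of_eq_mul (Homeomorph.ext (h v)))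

end Normalizer

theorem mulSupport_eq_image {X Y Γ Γ' : Type*} [Group Γ] [Group Γ'] (φ : X ≃ Y) {a : X → Γ}
    {b : Y → Γ'} (f : X → Γ ≃* Γ') (h : ∀ x, b (φ x) = f x (a x)) :
    Function.mulSupport b = φ '' Function.mulSupport a := by
  ext y
  obtain ⟨x, rfl⟩ := φ.surjective y
  rw [φ.injective.mem_set_image, Function.mem_mulSupport, Function.mem_mulSupport, h,
    map_ne_one_iff _ (f x).injective]

theorem theorem2 {Γ Γ' : Type*} [Group Γ] [Group Γ'] (α₀ α₁ : MulAut Γ) (β₀ β₁ : MulAut Γ')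
    (θ : FractionGroup α₀ α₁ ≃* FractionGroup β₀ β₁) :
    ∃ (ζ : FractionGroup α₀ α₁ →* Subgroup.center (FractionGroup β₀ β₁))
      (φ : Subgroup.normalizer (ThompsonV : Set (Cantor ≃ₜ Cantor)))
      (κ : LoopGroup Γ ≃* LoopGroup Γ')
      (c : ThompsonV → LoopGroup Γ'),
      -- `c` is a cocycle for the action of `V` on `LΓ'` through `ad φ`
      (∀ v w : ThompsonV, c (v * w) = c v * jonesAction β₀ β₁ (ThompsonV.ad φ v) (c w)) ∧
      -- the decomposition of `θ`
      (∀ (a : LoopGroup Γ) (v : ThompsonV),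
        θ (SemidirectProduct.inl a * SemidirectProduct.inr v) =
          (ζ (SemidirectProduct.inl a) : FractionGroup β₀ β₁) * SemidirectProduct.inl (κ a) *
            SemidirectProduct.inl (c v) * SemidirectProduct.inr (ThompsonV.ad φ v)) ∧
      -- `κ` is spatial
      (∀ a : LoopGroup Γ,
        Function.mulSupport (κ a) = (φ : Cantor ≃ₜ Cantor) '' Function.mulSupport a) ∧
      -- `κ` splits pointwise, compatibly with the twists
      ∃ κₓ : Cantor → (Γ ≃* Γ'),
        (∀ (a : LoopGroup Γ) (x : Cantor), κ a ((φ : Cantor ≃ₜ Cantor) x) = κₓ x (a x)) ∧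
        ∀ (x : Cantor) (v : ThompsonV) (g : Γ),
          κₓ ((v : Cantor ≃ₜ Cantor) x) (tau α₀ α₁ v x g) =
            MulAut.conj (c v ((φ : Cantor ≃ₜ Cantor) ((v : Cantor ≃ₜ Cantor) x)))
              (tau β₀ β₁ (ThompsonV.ad φ v) ((φ : Cantor ≃ₜ Cantor) x) (κₓ x g)) := by
  have hθ : PreservesKernel θ := FractionGroup.preservesKernel θ
  let ψ : ThompsonV ≃* ThompsonV := hθ.quotientEquiv
  let c (v : ThompsonV) : LoopGroup Γ' := (θ (SemidirectProduct.inr v)).left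
  obtain ⟨φ, hφ⟩ := exists_homeomorph_of_mulEquiv (X := Cantor) (Y := Cantor) ψ
  obtain ⟨ζ, κ, κₓ, hζ, hζv, hκζ, hκ, hκₓ⟩ := exists_spatial_decomposition
    (τ := tauCocycle α₀ α₁) (σ := tauCocycle β₀ β₁) ψ φ hφ hθ.kernelEquiv c hθ.kernelEquiv_smul
  have had (v : ThompsonV) : ThompsonV.ad ⟨φ, mem_normalizer_of_map_smul hφ⟩ v = ψ v :=
    ad_eq_of_map_smul hφ v
  refine ⟨centralHom ζ hζ hζv, ⟨φ, mem_normalizer_of_map_smul hφ⟩, κ, c, fun v w => ?_,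
    fun a v => ?_, fun a => mulSupport_eq_image φ.toEquiv κₓ (hκ a), κₓ, hκ, fun x v g => ?_⟩
  · rw [had]
    exact hθ.left_map_inr_mul v w
  · rw [had, map_mul, hθ.map_inl, hθ.map_inr, hκζ, map_mul, ← mul_assoc]
    rfl
  · rw [had]
    exact hκₓ v x g
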